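/- Consider the rank-six quartic melonic $U(1)$ tensorial group field theory with gauge invariance $\sum_{c} p_c=0$. A Feynman graph $\mathcal G$ has finitely many vertices $v$. Each vertex carries a special colour $c(v)\in\{1,\dots,6\}$ and has two ends, each end bearing one field $\phi$ and one field $\bar\phi$. The bubble of $v$ joins, for every colour $c\neq c(v)$, the $\phi$ and the $\bar\phi$ of the same end, and for $c=c(v)$ the $\phi$ of each end to the $\bar\phi$ of the other end. Lines (colour $0$) join some of the fields $\phi$ to some of the fields $\bar\phi$, each field being in at most one line. In the intermediate-field representation the vertices become wavy lines of colour $c(v)$ with two ends, and the lines become arcs, an arc going from the end that bears its $\phi$ to the end that bears its $\bar\phi$; the cycles of arcs are the loop vertices. A proper intermediate (PI) subgraph $\mathcal H$ is a subgraph whose lines are exactly the arcs of a set of loop vertices of $\mathcal G$, together with all vertices attached to them. Its external lines are the half-lines at its vertices that belong to no line of $\mathcal H$. A wavy line is internal if both its ends lie on loop vertices of $\mathcal H$, and external if exactly one end does. The faces of $\mathcal H$ of colour $c$ are the connected components of the graph formed by the lines of $\mathcal H$ and the bubble edges of colour $c$; a face is internal if it does not end at external half-lines, and otherwise it is open. The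 divergence degree is $\omega(\mathcal H)=-2L(\mathcal H)+F(\mathcal H)-R(\mathcal H)$, where $L$ is the number of lines, $F$ the number of internal faces, and $R$ the rank of the adjacency matrix of lines and internal faces. $\mathcal H$ is superficially divergent if $\omega(\mathcal H)\ge 0$. The degree of a closed coloured graph is the sum of the genera of its jackets, and a graph with external lines is melonic if it is obtained from a closed graph of degree zero by cutting lines of colour $0$. Theorem. Let $\mathcal H$ be a connected PI subgraph which is not a vacuum graph (it has at least one external wavy line). If $\mathcal H$ is superficially divergent, then it is melonic in the ordinary representation and has exactly two or four external lines. Moreover, $\mathcal H$ is superficially divergent if and only if in the intermediate-field representation it is a tree of loop vertices and internal wavy lines which has either (i) exactly one external wavy line, or (ii) exactly two external wavy lines, which have the same colour $c$ and carry the same strand momentum (one open face of colour $c$ runs from the one to the other). In case (i) $\mathcal H$ has two external lines and $\omega(\mathcal H)=2$; in case (ii) it has four external lines and $\omega(\mathcal H)=0$. -/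

import Mathlib

/-! ### Closed bipartite edge-coloured graphs, jackets and degree -/

/-- A closed bipartite edge-coloured graph, regular of valency the number of colours: black nodes `B`,
white nodes `W`, colours `K`; the edge of colour `a` at the black node `x` ends at `edge a x`. -/
structure ColoredGraph (K B W : Type*) where
  edge : K → B ≃ W

namespace ColoredGraph

variable {K B W : Type*}

/-- Two nodes are joined by an edge whose colour lies in `s`. -/
inductive Adj (Γ : ColoredGraph K B W) (s : Set K) : B ⊕ W → B ⊕ W → Prop
  | mk (a : K) (ha : a ∈ s) (x : B) : Adj Γ s (Sum.inl x) (Sum.inr (Γ.edge a x))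

/-- Number of connected components of the subgraph formed by the edges with colours in `s`. -/
noncomputable def numComponents (Γ : ColoredGraph K B W) (s : Set K) : ℕ :=
  Nat.card (Quot (Γ.Adj s))

/-- Genus of the jacket of the cyclic ordering `ξ` of the colours. The jacket is the ribbon graph with
all nodes and edges of the graph, and with the faces (bicoloured components) of two colours
that are consecutive for `ξ`. Its genus is read off from `2 k - 2 g = (nodes) - (edges) + (faces)`,
where `k` is the number of connected components. -/
noncomputable def jacketGenus [Fintype K] (Γ : ColoredGraph K B W) (ξ : Equiv.Perm K) : ℚ :=
  (2 * (Γ.numComponents Set.univ : ℚ)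
    - (((Nat.card B : ℚ) + Nat.card W) - (Fintype.card K : ℚ) * Nat.card B
        + ∑ a : K, (Γ.numComponents {a, ξ a} : ℚ))) / 2

open Classical in
/-- The degree: the sum of the genera of the jackets. Each jacket is given by a cyclic ordering
of all the colours up to orientation, so that it occurs twice in the sum over cyclic orderings. -/
noncomputable def degree [Fintype K] (Γ : ColoredGraph K B W) : ℚ :=
  (∑ ξ ∈ (Finset.univ : Finset (Equiv.Perm K)).filter (fun ξ => ξ.IsCycleOn Set.univ),
    Γ.jacketGenus ξ) / 2

end ColoredGraph

/-! ### Feynman graphs of the quartic melonic model of rank six -/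

/-- A vertex of the quartic model has two ends (the two ends of the wavy line that represents
the vertex in the intermediate field representation). The end `(v, s)` bears one field `φ` and one
field `φ̄`. -/
abbrev HalfWavy (V : Type*) := V × Bool

/-- A Feynman graph of the rank six quartic model with vertex set `V`. The vertex `v` is the bubble
`b_c` with special colour `c = color v`. The Wick contraction `h' ∈ contraction h` is the
line (arc) which joins the field `φ` of the end `h` to the field `φ̄` of the end `h'`; fields without
a contraction are external half-lines of the graph. A line is named by the end `h` that bears
its field `φ`. -/
structure FeynmanGraph (V : Type*) where
  color : V → Fin 6
  contraction : HalfWavy V ≃. HalfWavy V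

namespace FeynmanGraph

variable {V : Type*} (G : FeynmanGraph V)

/-- The edge of colour `c` of a bubble joins the `φ` of the end `h` to the `φ̄` of the end
`G.strand c h`: that of the same end, except for the special colour of the bubble, where it is that
of the opposite end. -/
def strand (c : Fin 6) (h : HalfWavy V) : HalfWavy V :=
  if c = G.color h.1 then (h.1, !h.2) else h

theorem strand_fst (c : Fin 6) (h : HalfWavy V) : (G.strand c h).1 = h.1 := by
  unfold strand; split_ifs <;> rfl

theorem strand_strand (c : Fin 6) (h : HalfWavy V) : G.strand c (G.strand c h) = h := by
  rcases h with ⟨v, s⟩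
  by_cases hc : c = G.color v <;> simp [strand, hc]

/-! #### Subgraphs in the ordinary representation: sets of lines -/

/-- The end `h'` bears the field `φ̄` of a line of `S`. -/
def IsTarget (S : Set (HalfWavy V)) (h' : HalfWavy V) : Prop :=
  ∃ h ∈ S, h' ∈ G.contraction h

/-- The vertices attached to the lines of `S`. -/
def vertices (S : Set (HalfWavy V)) : Set V :=
  {v | ∃ s : Bool, (v, s) ∈ S ∨ G.IsTarget S (v, s)}

/-- Number of external lines of `S`: half-lines (`φ` or `φ̄`) at the vertices of `S` that belong to
no line of `S`. -/
noncomputable def numExternalLines (S : Set (HalfWavy V)) : ℕ :=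
  Nat.card {h : HalfWavy V // h.1 ∈ G.vertices S ∧ h ∉ S} +
    Nat.card {h : HalfWavy V // h.1 ∈ G.vertices S ∧ ¬ G.IsTarget S h}

/-- Nodes of the coloured extension: `Sum.inl h` is the field `φ` and `Sum.inr h` the field
`φ̄` of the end `h`. -/
abbrev Node (V : Type*) := HalfWavy V ⊕ HalfWavy V

/-- Two nodes are joined by a line of `S` (an edge of colour 0) or by a bubble edge of colour `c`. -/
inductive FaceAdj (S : Set (HalfWavy V)) (c : Fin 6) : Node V → Node V → Prop
  | line (h h' : HalfWavy V) (hS : h ∈ S) (hh : h' ∈ G.contraction h) :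
      FaceAdj S c (Sum.inl h) (Sum.inr h')
  | bubble (h : HalfWavy V) : FaceAdj S c (Sum.inl h) (Sum.inr (G.strand c h))

/-- The faces of colour `c`, closed or open: the connected components for the colours 0 and `c`. -/
def Face (S : Set (HalfWavy V)) (c : Fin 6) : Type _ := Quot (G.FaceAdj S c)

/-- The face of colour `c` through a node. -/
def faceAt (S : Set (HalfWavy V)) (c : Fin 6) (x : Node V) : G.Face S c := Quot.mk _ x

/-- The node belongs to a line of `S`. -/
def OnLine (S : Set (HalfWavy V)) : Node V → Prop
  | Sum.inl h => h ∈ S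
  | Sum.inr h => G.IsTarget S h

/-- The internal (closed) faces of `S`, of all colours: those that do not end at a half-line which
belongs to no line of `S`. -/
def InternalFace (S : Set (HalfWavy V)) : Type _ :=
  Σ c : Fin 6, {f : G.Face S c // ∀ x : Node V, G.faceAt S c x = f → G.OnLine S x}

open Classical in
/-- The adjacency matrix of the lines and the internal faces of `S`. Orienting lines and faces
from `φ` to `φ̄` along the lines, all incidences are positive. -/
noncomputable def incidence (S : Set (HalfWavy V)) : Matrix S (G.InternalFace S) ℚ :=
  fun l f => if G.faceAt S f.1 (Sum.inl l.1) = f.2.1 then 1 else 0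

/-- The rank `R` of the adjacency matrix (the dimension of its row space). -/
noncomputable def incidenceRank (S : Set (HalfWavy V)) : ℕ :=
  Module.finrank ℚ (Submodule.span ℚ (Set.range (G.incidence S)))

/-- The divergence degree `ω = -2 L + F - R`. -/
noncomputable def divergenceDegree (S : Set (HalfWavy V)) : ℤ :=
  -2 * (Nat.card S : ℤ) + (Nat.card (G.InternalFace S) : ℤ) - (G.incidenceRank S : ℤ)

/-- The half wavy lines at the vertices of `S`. -/
abbrev Ends (S : Set (HalfWavy V)) := {h : HalfWavy V // h.1 ∈ G.vertices S}

/-- The bubble edges of colour `c` at the vertices of `S`. -/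
def bubbleEquiv (S : Set (HalfWavy V)) (c : Fin 6) : G.Ends S ≃ G.Ends S where
  toFun h := ⟨G.strand c h.1, by rw [strand_fst]; exact h.2⟩
  invFun h := ⟨G.strand c h.1, by rw [strand_fst]; exact h.2⟩
  left_inv h := Subtype.ext (G.strand_strand c h.1)
  right_inv h := Subtype.ext (G.strand_strand c h.1)

/-- The closed coloured graph (seven colours, `none` being the colour 0) on the vertices of `S` with
the lines `e`. -/
def closedGraph (S : Set (HalfWavy V)) (e : G.Ends S ≃ G.Ends S) :
    ColoredGraph (Option (Fin 6)) (G.Ends S) (G.Ends S) where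
  edge a := a.elim e (G.bubbleEquiv S)

/-- `S` is melonic in the ordinary representation: it is obtained from a closed graph of degree
zero by cutting lines (of colour 0) into pairs of external half-lines. -/
def IsMelonic (S : Set (HalfWavy V)) : Prop :=
  ∃ e : G.Ends S ≃ G.Ends S,
    (∀ h : G.Ends S, h.1 ∈ S → (e h).1 ∈ G.contraction h.1) ∧ (G.closedGraph S e).degree = 0

/-! #### The intermediate field representation -/

/-- `h'` follows `h` on the boundary of a disk: there is an arc from `h` to `h'`. -/
def Next (h h' : HalfWavy V) : Prop := h' ∈ G.contraction h

/-- The loop vertices (cycles of arcs), each given as the set of its half wavy lines, equivalently of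
its arcs. The chains (ciliated vertices) are the sequences of arcs that do not close. -/
def loopVertices : Set (Set (HalfWavy V)) :=
  {A | ∃ h, Relation.TransGen G.Next h h ∧ A = {h' | Relation.TransGen G.Next h h'}}

/-- A proper intermediate (PI) subgraph: its arcs are exactly those of a set of loop vertices. -/
structure PISubgraph where
  loops : Set (Set (HalfWavy V))
  loops_subset : loops ⊆ G.loopVertices

namespace PISubgraph

variable {G} (H : G.PISubgraph)

/-- The lines (arcs) of the subgraph. -/
def lines : Set (HalfWavy V) := ⋃₀ H.loops

/-- The wavy line `v` joins the loop vertices `A` and `B`. -/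
def Joins (v : V) (A B : H.loops) : Prop :=
  ((v, false) ∈ A.1 ∧ (v, true) ∈ B.1) ∨ ((v, true) ∈ A.1 ∧ (v, false) ∈ B.1)

/-- The graph of the loop vertices of `H`, joined by the internal wavy lines of `H`, with
multiplicities and self-loops forgotten. -/
def simpleGraph : SimpleGraph H.loops where
  Adj A B := A ≠ B ∧ ∃ v, H.Joins v A B
  symm := ⟨fun _ _ h => ⟨h.1.symm, h.2.imp fun _ hv => hv.symm.imp And.symm And.symm⟩⟩
  loopless := ⟨fun _ h => h.1 rfl⟩

/-- `H` is connected (in particular it has a loop vertex). -/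
def Connected : Prop := H.simpleGraph.Connected

/-- `H` is a tree of loop vertices and wavy lines: no self-loop, no pair of wavy lines between the
same loop vertices, and the underlying simple graph is a tree. -/
def IsTree : Prop :=
  H.simpleGraph.IsTree ∧
    (∀ v A, ¬ H.Joins v A A) ∧
    (∀ v w A B, H.Joins v A B → H.Joins w A B → v = w)

/-- The external wavy lines of `H`, each given by its end on `H`: wavy lines with only one end
on a loop vertex of `H`. -/
def externalWavy : Set (HalfWavy V) :=
  {h | h ∈ H.lines ∧ (h.1, !h.2) ∉ H.lines}

/-- The number of external wavy lines. -/
noncomputable def numExternalWavy : ℕ := Nat.card H.externalWavy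

/-- The external wavy lines `h` and `h'` have the same colour `c` and carry the same strand momentum:
one open face of colour `c` of the subgraph runs from the one to the other. -/
def SameStrand (h h' : HalfWavy V) : Prop :=
  G.color h.1 = G.color h'.1 ∧
    (G.faceAt H.lines (G.color h.1) (Sum.inl h) = G.faceAt H.lines (G.color h.1) (Sum.inr h') ∨
     G.faceAt H.lines (G.color h.1) (Sum.inl h') = G.faceAt H.lines (G.color h.1) (Sum.inr h))

/-- Exactly two external wavy lines, of the same colour and with the same strand momentum. -/
def HasMonocolorPair : Prop :=
  H.numExternalWavy = 2 ∧
    ∃ h ∈ H.externalWavy, ∃ h' ∈ H.externalWavy, h ≠ h' ∧ H.SameStrand h h'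

/-- The divergence degree of the PI subgraph. -/
noncomputable def omega : ℤ := G.divergenceDegree H.lines

end PISubgraph

end FeynmanGraph

/-! ### Arcs, and loop vertices as closed orbits of the arc map. -/

namespace FeynmanGraph

open Relation

variable {V : Type*} {G : FeynmanGraph V}

/-! By rank-nullity, ω = -2L + dim ker, where the kernel consists of the functions on internal faces
whose values sum to zero over the six colours on every line. Extend such a function by zero to the
open faces. When one passes from an arc to the next one on a loop vertex, only the face of the
special colour of the wavy line in between can change; the sum rule then forces that value to stay
the same too. So a kernel element is a family u_c(A) indexed by colours c and loop vertices A, with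
zero sum over c, with equal values of u_c at the two ends of an internal wavy line of colour c, and
with u_c = 0 at an external one (`loopSpace`). With I internal and E external wavy lines, L = 2I + E
gives ω = dim - 4I - 2E (`omega_eq`).

Let n be the number of loop vertices. Explore them from a root that bears an external wavy line: at
each loop vertex one of the six values is fixed by its parent (at the root, by the external line)
and one by the sum rule, so dim ≤ 4n (`finrank_loopSpace_le`). Connectedness gives n ≤ I + 1, with
equality exactly for trees (`isTree_iff`). Hence ω ≤ 4(n - I) - 2E, and ω ≥ 0 with E ≥ 1 forces a
tree with E = 1, or a tree with E = 2 and dim = 4n. In the latter case the condition of the second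
external line must already follow from that of the first, which means that wavy lines of a common
colour tie the two together (`colorConn_of_eq_zero`); a flow argument on the tree turns this into an
open face running between them (`sameStrand_of_colorConn`). Conversely, counting equations gives dim
≥ 4n in both cases (`le_finrank_loopSpace`).

For melonicity, each free end is closed by an arc to itself. The result is again a tree, with one
more loop vertex than wavy lines. There the number of faces with colours a, b has the form w(a) +
w(b), so every jacket has the same Euler characteristic, that of the sphere (`degree_closureGraph`).
-/

theorem Next.right_unique {h a b : HalfWavy V} (ha : G.Next h a) (hb : G.Next h b) : a = b :=
  Option.mem_unique ha hb

theorem Next.left_unique {h a b : HalfWavy V} (ha : G.Next a h) (hb : G.Next b h) : a = b :=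
  G.contraction.inj ha hb

theorem Next.eq_or_transGen {h x k : HalfWavy V} (hx : G.Next h x) (hk : TransGen G.Next h k) :
    x = k ∨ TransGen G.Next x k := by
  obtain ⟨y, hy, hyk⟩ := TransGen.head'_iff.1 hk
  obtain rfl := hx.right_unique hy
  rcases reflTransGen_iff_eq_or_transGen.1 hyk with h | h
  · exact Or.inl h.symm
  · exact Or.inr h

/-- Successors are unique, so each step taken along the cycle merely removes the first step of the
way back to `h`; when nothing is left, one is at `h` and the whole cycle is available again. -/
theorem transGen_symm_of_cycle {h h' : HalfWavy V} (hh : TransGen G.Next h h)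
    (hh' : TransGen G.Next h h') : TransGen G.Next h' h := by
  induction hh' with
  | single hb => rcases hb.eq_or_transGen hh with rfl | h
                 · exact hh
                 · exact h
  | tail _ hc ih => rcases hc.eq_or_transGen ih with rfl | h
                    · exact hh
                    · exact h

namespace PISubgraph

variable (H : G.PISubgraph)

variable {H} in
-- Any end of a cycle generates the whole cycle; this is what makes distinct loop vertices disjoint.
theorem loop_eq {A : Set (HalfWavy V)} (hA : A ∈ H.loops) {h : HalfWavy V} (hh : h ∈ A) :
    TransGen G.Next h h ∧ A = {h' | TransGen G.Next h h'} := by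
  obtain ⟨k, hk, rfl⟩ := H.loops_subset hA
  have hs := transGen_symm_of_cycle hk hh
  refine ⟨hs.trans hh, Set.ext fun x => ⟨fun hx => hs.trans hx, fun hx => TransGen.trans hh hx⟩⟩

variable {H} in
theorem loop_nonempty {A : Set (HalfWavy V)} (hA : A ∈ H.loops) : A.Nonempty := by
  obtain ⟨k, hk, rfl⟩ := H.loops_subset hA
  exact ⟨k, hk⟩

variable {H} in
theorem loop_unique {A B : Set (HalfWavy V)} (hA : A ∈ H.loops) (hB : B ∈ H.loops)
    {h : HalfWavy V} (ha : h ∈ A) (hb : h ∈ B) : A = B :=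
  (loop_eq hA ha).2.trans (loop_eq hB hb).2.symm

variable {H} in
theorem mem_loop_of_next {A : Set (HalfWavy V)} (hA : A ∈ H.loops) {h h' : HalfWavy V}
    (hn : G.Next h h') (hh : h ∈ A) : h' ∈ A := by
  rw [(loop_eq hA hh).2]
  exact TransGen.single hn

variable {H} in
theorem exists_next_mem {A : Set (HalfWavy V)} (hA : A ∈ H.loops) {h : HalfWavy V} (hh : h ∈ A) :
    ∃ h' ∈ A, G.Next h h' := by
  obtain ⟨y, hy, -⟩ := TransGen.head'_iff.1 (loop_eq hA hh).1
  exact ⟨y, mem_loop_of_next hA hy hh, hy⟩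

variable {H} in
theorem exists_prev_mem {A : Set (HalfWavy V)} (hA : A ∈ H.loops) {h : HalfWavy V} (hh : h ∈ A) :
    ∃ h' ∈ A, G.Next h' h := by
  obtain ⟨y, hy, hn⟩ := TransGen.tail'_iff.1 (loop_eq hA hh).1
  refine ⟨y, ?_, hn⟩
  rcases reflTransGen_iff_eq_or_transGen.1 hy with h | h
  · exact h ▸ hh
  · rw [(loop_eq hA hh).2]; exact h

variable {H} in
theorem mem_loop_of_next' {A : Set (HalfWavy V)} (hA : A ∈ H.loops) {h h' : HalfWavy V}
    (hn : G.Next h h') (hh : h' ∈ A) : h ∈ A := by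
  obtain ⟨k, hk, hkn⟩ := exists_prev_mem hA hh
  rwa [hn.left_unique hkn]

/-- The arc that starts at an end of `H` stays in `H`. -/
theorem exists_next {h : HalfWavy V} (hh : h ∈ H.lines) : ∃ h' ∈ H.lines, G.Next h h' := by
  obtain ⟨A, hA, hhA⟩ := hh
  obtain ⟨k, hk, hn⟩ := exists_next_mem hA hhA
  exact ⟨k, ⟨A, hA, hk⟩, hn⟩

theorem exists_prev {h : HalfWavy V} (hh : h ∈ H.lines) : ∃ h' ∈ H.lines, G.Next h' h := by
  obtain ⟨A, hA, hhA⟩ := hh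
  obtain ⟨k, hk, hn⟩ := exists_prev_mem hA hhA
  exact ⟨k, ⟨A, hA, hk⟩, hn⟩

variable {H} in
theorem mem_lines_of_next {h h' : HalfWavy V} (hn : G.Next h h') (hh : h ∈ H.lines) :
    h' ∈ H.lines := by
  obtain ⟨A, hA, hhA⟩ := hh
  exact ⟨A, hA, mem_loop_of_next hA hn hhA⟩

variable {H} in
-- Loop vertices are closed under successor and predecessor, so the two fields of an end are both on
-- lines of `H` or both external. External half-lines therefore come in pairs, one pair per free
-- end.
theorem isTarget_iff {h : HalfWavy V} : G.IsTarget H.lines h ↔ h ∈ H.lines :=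
  ⟨fun ⟨_, hk, hn⟩ => mem_lines_of_next hn hk, fun hh => H.exists_prev hh⟩

variable {H} in
theorem onLine_inr_iff {h : HalfWavy V} : G.OnLine H.lines (Sum.inr h) ↔ h ∈ H.lines := isTarget_iff

variable {H} in
theorem mem_vertices_iff {v : V} : v ∈ G.vertices H.lines ↔ ∃ s : Bool, (v, s) ∈ H.lines := by
  simp [vertices, isTarget_iff]

variable {H} in
theorem mem_vertices_of_mem {h : HalfWavy V} (hh : h ∈ H.lines) : h.1 ∈ G.vertices H.lines :=
  mem_vertices_iff.2 ⟨h.2, hh⟩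

/-- The loop vertex of an end of `H`. -/
noncomputable def loopOf (h : H.lines) : H.loops := ⟨h.2.choose, h.2.choose_spec.1⟩

variable {H} in
theorem mem_loopOf (h : H.lines) : h.1 ∈ (H.loopOf h).1 := h.2.choose_spec.2

variable {H} in
theorem loopOf_eq {h : HalfWavy V} (hh : h ∈ H.lines) {A : H.loops} (hA : h ∈ A.1) :
    H.loopOf ⟨h, hh⟩ = A :=
  Subtype.ext (loop_unique (H.loopOf ⟨h, hh⟩).2 A.2 (mem_loopOf ⟨h, hh⟩) hA)

variable {H} in
theorem mem_lines_of_mem {h : HalfWavy V} {A : H.loops} (hA : h ∈ A.1) : h ∈ H.lines :=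
  ⟨A.1, A.2, hA⟩

variable {H} in
theorem loopOf_next {h h' : HalfWavy V} (hh : h ∈ H.lines) (hh' : h' ∈ H.lines)
    (hn : G.Next h h') : H.loopOf ⟨h', hh'⟩ = H.loopOf ⟨h, hh⟩ :=
  loopOf_eq hh' (mem_loop_of_next (H.loopOf _).2 hn (mem_loopOf ⟨h, hh⟩))

/-- An end on a loop vertex. -/
noncomputable def rep (A : H.loops) : HalfWavy V := (loop_nonempty A.2).choose

theorem rep_mem (A : H.loops) : H.rep A ∈ A.1 := (loop_nonempty A.2).choose_spec

theorem rep_mem_lines (A : H.loops) : H.rep A ∈ H.lines := mem_lines_of_mem (H.rep_mem A)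

variable {H} in
theorem eq_of_mem_loop {α : Type*} {f : HalfWavy V → α}
    (hf : ∀ h ∈ H.lines, ∀ h', G.Next h h' → f h = f h') {A : H.loops} {h h' : HalfWavy V}
    (hh : h ∈ A.1) (hh' : h' ∈ A.1) : f h = f h' := by
  rw [(loop_eq A.2 hh).2] at hh'
  have key : f h = f h' ∧ h' ∈ A.1 := by
    induction hh' with
    | single hb => exact ⟨hf _ (mem_lines_of_mem hh) _ hb, mem_loop_of_next A.2 hb hh⟩
    | tail _ hc ih =>
      exact ⟨ih.1.trans (hf _ (mem_lines_of_mem ih.2) _ hc), mem_loop_of_next A.2 hc ih.2⟩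
  exact key.1

/-! ### Counting ends -/

/-- The internal wavy lines. -/
def internalWavy : Set V := {v | (v, false) ∈ H.lines ∧ (v, true) ∈ H.lines}

variable {H} in
theorem mem_internalWavy_of {h : HalfWavy V} (h1 : h ∈ H.lines) (h2 : (h.1, !h.2) ∈ H.lines) :
    h.1 ∈ H.internalWavy := by
  rcases h with ⟨v, _ | _⟩
  · exact ⟨h1, h2⟩
  · exact ⟨h2, h1⟩

variable {H} in
theorem mem_lines_of_internalWavy {v : V} (hv : v ∈ H.internalWavy) (s : Bool) :
    (v, s) ∈ H.lines := by
  cases s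
  · exact hv.1
  · exact hv.2

/-- Arcs are named by ends; an internal wavy line has both its ends on `H`, an external one only
one. -/
theorem card_lines [Finite V] :
    Nat.card H.lines = 2 * Nat.card H.internalWavy + H.numExternalWavy := by
  classical
  have e : H.lines ≃ (H.internalWavy × Bool) ⊕ H.externalWavy :=
    { toFun := fun h => if hh : (h.1.1, !h.1.2) ∈ H.lines then
          Sum.inl (⟨h.1.1, mem_internalWavy_of h.2 hh⟩, h.1.2) else Sum.inr ⟨h.1, h.2, hh⟩
      invFun := Sum.elim (fun p => ⟨(p.1.1, p.2), mem_lines_of_internalWavy p.1.2 p.2⟩)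
        (fun h => ⟨h.1, h.2.1⟩)
      left_inv := fun h => by
        by_cases hh : (h.1.1, !h.1.2) ∈ H.lines <;> simp [hh]
      right_inv := by
        rintro (⟨⟨v, hv⟩, s⟩ | ⟨h, h1, h2⟩)
        · simp [mem_lines_of_internalWavy hv (!s)]
        · simp [h2] }
  rw [Nat.card_congr e, Nat.card_sum, Nat.card_prod, numExternalWavy]
  simp [mul_comm]

/-- The ends, not on `H`, of the external wavy lines. -/
abbrev Free := {h : HalfWavy V // h.1 ∈ G.vertices H.lines ∧ h ∉ H.lines}

/-- An external wavy line has one end on `H` and the other one free. -/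
def freeEquiv : H.externalWavy ≃ H.Free where
  toFun h := ⟨(h.1.1, !h.1.2), mem_vertices_of_mem (h := h.1) h.2.1, h.2.2⟩
  invFun h := ⟨(h.1.1, !h.1.2), by
    obtain ⟨⟨v, s⟩, h1, h2⟩ := h
    obtain ⟨t, ht⟩ := mem_vertices_iff.1 h1
    have : t = !s := by
      rcases Bool.eq_or_eq_not t s with rfl | h
      · exact absurd ht h2
      · exact h
    subst this
    exact ⟨ht, by simpa using h2⟩⟩
  left_inv h := by simp
  right_inv h := by simp

theorem card_free : Nat.card H.Free = H.numExternalWavy :=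
  (Nat.card_congr H.freeEquiv).symm

theorem numExternalLines_eq : G.numExternalLines H.lines = 2 * H.numExternalWavy := by
  unfold numExternalLines
  simp only [isTarget_iff]
  rw [← H.card_free]
  ring

/-- The ends at the vertices of `H`. -/
def endsEquiv : G.Ends H.lines ≃ G.vertices H.lines × Bool where
  toFun h := (⟨h.1.1, h.2⟩, h.1.2)
  invFun p := ⟨(p.1.1, p.2), p.1.2⟩
  left_inv _ := rfl
  right_inv _ := rfl

theorem card_vertices [Finite V] :
    Nat.card (G.vertices H.lines) = Nat.card H.internalWavy + H.numExternalWavy := by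
  classical
  have e : G.Ends H.lines ≃ H.lines ⊕ H.Free :=
    { toFun := fun h => if hh : h.1 ∈ H.lines then Sum.inl ⟨h.1, hh⟩ else Sum.inr ⟨h.1, h.2, hh⟩
      invFun := Sum.elim (fun h => ⟨h.1, mem_vertices_of_mem h.2⟩) (fun h => ⟨h.1, h.2.1⟩)
      left_inv := fun h => by by_cases hh : h.1 ∈ H.lines <;> simp [hh]
      right_inv := by
        rintro (⟨h, hh⟩ | ⟨h, h1, h2⟩)
        · simp [hh]
        · simp [h2] }
  have h1 := Nat.card_congr e
  rw [Nat.card_congr H.endsEquiv, Nat.card_sum, Nat.card_prod, H.card_lines, H.card_free] at h1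
  simp only [Nat.card_eq_fintype_card, Fintype.card_bool] at h1
  omega

end PISubgraph

end FeynmanGraph

namespace FeynmanGraph

open Relation

variable {V : Type*} {G : FeynmanGraph V}

/-! ### The kernel of the incidence matrix -/

section Kernel

variable {S : Set (HalfWavy V)}

instance [Finite V] (c : Fin 6) : Finite (G.Face S c) :=
  inferInstanceAs (Finite (Quot (G.FaceAdj S c)))

instance [Finite V] : Finite (G.InternalFace S) :=
  inferInstanceAs (Finite (Σ c : Fin 6, {f : G.Face S c // ∀ x, G.faceAt S c x = f → G.OnLine S x}))

noncomputable instance [Finite V] : Fintype (G.InternalFace S) := Fintype.ofFinite _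

/-- Rank-nullity for the matrix acting on functions on internal faces: F - R is the dimension of its
kernel. -/
theorem divergenceDegree_eq [Finite V] :
    G.divergenceDegree S = -2 * (Nat.card S : ℤ)
      + Module.finrank ℚ (LinearMap.ker (G.incidence S).mulVecLin) := by
  have h1 : G.incidenceRank S = (G.incidence S).rank :=
    ((G.incidence S).rank_eq_finrank_span_row).symm
  have h2 := LinearMap.finrank_range_add_finrank_ker (G.incidence S).mulVecLin
  rw [Module.finrank_fintype_fun_eq_card, ← Nat.card_eq_fintype_card] at h2
  rw [divergenceDegree, h1, Matrix.rank]
  omega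

open Classical in
/-- The extension by zero to open faces of a function on internal faces. -/
noncomputable def extendZero (y : G.InternalFace S → ℚ) (c : Fin 6) (f : G.Face S c) : ℚ :=
  if hf : ∀ x : Node V, G.faceAt S c x = f → G.OnLine S x then y ⟨c, f, hf⟩ else 0

theorem extendZero_internal (y : G.InternalFace S → ℚ) (f : G.InternalFace S) :
    extendZero y f.1 f.2.1 = y f := dif_pos f.2.2

theorem extendZero_open (y : G.InternalFace S → ℚ) (c : Fin 6) {x : Node V}
    (hx : ¬ G.OnLine S x) : extendZero y c (G.faceAt S c x) = 0 :=
  dif_neg fun h => hx (h x rfl)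

theorem extendZero_add (y y' : G.InternalFace S → ℚ) (c : Fin 6) (f : G.Face S c) :
    extendZero (y + y') c f = extendZero y c f + extendZero y' c f := by
  unfold extendZero
  split_ifs
  · rfl
  · simp

theorem extendZero_smul (a : ℚ) (y : G.InternalFace S → ℚ) (c : Fin 6) (f : G.Face S c) :
    extendZero (a • y) c f = a * extendZero y c f := by
  unfold extendZero
  split_ifs
  · rfl
  · simp

/-- A line lies on exactly one face of each colour, so its row has at most one nonzero entry per
colour; extension by zero accounts for the open faces. -/
theorem mulVecLin_incidence_apply [Finite V] (y : G.InternalFace S → ℚ) (l : S) :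
    (G.incidence S).mulVecLin y l = ∑ c, extendZero y c (G.faceAt S c (Sum.inl l.1)) := by
  classical
  let _ : ∀ c : Fin 6,
      Fintype {f : G.Face S c // ∀ x : Node V, G.faceAt S c x = f → G.OnLine S x} :=
    fun c => Fintype.ofFinite _
  have : (G.incidence S).mulVecLin y l = ∑ f : (Σ c : Fin 6,
      {f : G.Face S c // ∀ x : Node V, G.faceAt S c x = f → G.OnLine S x}),
        G.incidence S l f * y f := by
    rw [Matrix.mulVecLin_apply, Matrix.mulVec, dotProduct]
    exact Fintype.sum_equiv (ι := G.InternalFace S) (κ := Σ c : Fin 6,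
      {f : G.Face S c // ∀ x : Node V, G.faceAt S c x = f → G.OnLine S x}) (Equiv.refl _)
      (fun f => G.incidence S l f * y f) (fun f => G.incidence S l f * y f) fun _ => rfl
  rw [this, Fintype.sum_sigma]
  refine Finset.sum_congr rfl fun c _ => ?_
  simp only [incidence, ite_mul, one_mul, zero_mul]
  unfold extendZero
  split_ifs with hf
  · rw [Finset.sum_eq_single ⟨G.faceAt S c (Sum.inl l.1), hf⟩]
    · simp
    · intro b _ hb
      exact if_neg fun h => hb (Subtype.ext h.symm)
    · simp
  · refine Finset.sum_eq_zero fun b _ => if_neg fun h => hf ?_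
    rw [h]
    exact b.2

theorem mem_ker_incidence [Finite V] {y : G.InternalFace S → ℚ} :
    y ∈ LinearMap.ker (G.incidence S).mulVecLin ↔
      ∀ l ∈ S, ∑ c, extendZero y c (G.faceAt S c (Sum.inl l)) = 0 := by
  rw [LinearMap.mem_ker, funext_iff]
  simp only [mulVecLin_incidence_apply, Subtype.forall, Pi.zero_apply]

theorem faceAt_line {c : Fin 6} {h h' : HalfWavy V} (hS : h ∈ S) (hn : G.Next h h') :
    G.faceAt S c (Sum.inl h) = G.faceAt S c (Sum.inr h') :=
  Quot.sound (FaceAdj.line h h' hS hn)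

theorem faceAt_strand (c : Fin 6) (h : HalfWavy V) :
    G.faceAt S c (Sum.inl h) = G.faceAt S c (Sum.inr (G.strand c h)) :=
  Quot.sound (FaceAdj.bubble h)

theorem strand_of_ne {c : Fin 6} {h : HalfWavy V} (hc : c ≠ G.color h.1) : G.strand c h = h :=
  if_neg hc

theorem strand_color (h : HalfWavy V) : G.strand (G.color h.1) h = (h.1, !h.2) := if_pos rfl

end Kernel

/-! ### The kernel as a space of functions on loop vertices. -/

namespace PISubgraph

variable (H : G.PISubgraph)

/-- Colour-wise functions on the loop vertices that sum to zero over the colours, agree along the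
internal wavy lines for their colours, and vanish for the colours of the external wavy lines. -/
def loopSpace : Submodule ℚ (Fin 6 → H.loops → ℚ) where
  carrier := {u | (∀ A, ∑ c, u c A = 0) ∧
    (∀ v A B, H.Joins v A B → u (G.color v) A = u (G.color v) B) ∧
    ∀ h ∈ H.externalWavy, ∀ A : H.loops, h ∈ A.1 → u (G.color h.1) A = 0}
  zero_mem' := by simp
  add_mem' := by
    rintro u u' ⟨h1, h2, h3⟩ ⟨h1', h2', h3'⟩
    refine ⟨fun A => ?_, fun v A B h => ?_, fun h hh A hA => ?_⟩
    · simp [Finset.sum_add_distrib, h1, h1']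
    · simp [h2 v A B h, h2' v A B h]
    · simp [h3 h hh A hA, h3' h hh A hA]
  smul_mem' := by
    rintro a u ⟨h1, h2, h3⟩
    refine ⟨fun A => ?_, fun v A B h => ?_, fun h hh A hA => ?_⟩
    · simp [← Finset.mul_sum, h1]
    · simp [h2 v A B h]
    · simp [h3 h hh A hA]

/-! ### From the kernel to functions on loop vertices. -/

section ToLoop

variable {H} [Finite V] {y : G.InternalFace H.lines → ℚ}

/-- At the end `h'` the faces of the five non-special colours run straight from one arc to the next,
so five of the six values agree; both arcs have zero sum, so the sixth agrees as well. -/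
theorem extendZero_next (hy : y ∈ LinearMap.ker (G.incidence H.lines).mulVecLin)
    {h h' : HalfWavy V} (hh : h ∈ H.lines) (hn : G.Next h h') (c : Fin 6) :
    extendZero y c (G.faceAt H.lines c (Sum.inl h)) =
      extendZero y c (G.faceAt H.lines c (Sum.inl h')) := by
  have key : ∀ c, c ≠ G.color h'.1 → extendZero y c (G.faceAt H.lines c (Sum.inl h)) =
      extendZero y c (G.faceAt H.lines c (Sum.inl h')) := fun c hc => by
    rw [faceAt_line hh hn, faceAt_strand c h', strand_of_ne hc]
  by_cases hc : c = G.color h'.1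
  · have h1 := mem_ker_incidence.1 hy h hh
    have h2 := mem_ker_incidence.1 hy h' (mem_lines_of_next hn hh)
    rw [← Finset.add_sum_erase _ _ (Finset.mem_univ c)] at h1 h2
    rw [Finset.sum_congr rfl fun d hd =>
      key d (fun hd' => (Finset.mem_erase.1 hd).1 (hd'.trans hc.symm))] at h1
    linarith
  · exact key c hc

theorem extendZero_loop (hy : y ∈ LinearMap.ker (G.incidence H.lines).mulVecLin)
    {A : H.loops} {h h' : HalfWavy V} (hh : h ∈ A.1) (hh' : h' ∈ A.1) (c : Fin 6) :
    extendZero y c (G.faceAt H.lines c (Sum.inl h)) =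
      extendZero y c (G.faceAt H.lines c (Sum.inl h')) :=
  eq_of_mem_loop (f := fun h => extendZero y c (G.faceAt H.lines c (Sum.inl h)))
    (fun _ hh _ hn => extendZero_next hy hh hn c) hh hh'

theorem extendZero_inr (hy : y ∈ LinearMap.ker (G.incidence H.lines).mulVecLin)
    {h : HalfWavy V} (hh : h ∈ H.lines) (c : Fin 6) :
    extendZero y c (G.faceAt H.lines c (Sum.inr h)) =
      extendZero y c (G.faceAt H.lines c (Sum.inl h)) := by
  obtain ⟨k, hk, hn⟩ := H.exists_prev hh
  rw [← faceAt_line hk hn]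
  exact extendZero_next hy hk hn c

omit [Finite V] in
/-- An internal face passes through a line. -/
theorem exists_line_of_internalFace (f : G.InternalFace H.lines) :
    ∃ h ∈ H.lines, f.2.1 = G.faceAt H.lines f.1 (Sum.inl h) := by
  obtain ⟨c, f, hf⟩ := f
  obtain ⟨x, rfl⟩ := Quot.exists_rep f
  have hx := hf x rfl
  rcases x with h | h
  · exact ⟨h, hx, rfl⟩
  · obtain ⟨k, hk, hn⟩ := H.exists_prev (onLine_inr_iff.1 hx)
    exact ⟨k, hk, (faceAt_line hk hn).symm⟩

variable (H) in
-- Kernel elements are constant around loop vertices, so one sampled arc on each suffices. Sampling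
-- is injective because every internal face passes through some line.
theorem finrank_ker_le : Module.finrank ℚ (LinearMap.ker (G.incidence H.lines).mulVecLin) ≤
    Module.finrank ℚ H.loopSpace := by
  let φ : LinearMap.ker (G.incidence H.lines).mulVecLin →ₗ[ℚ] H.loopSpace :=
    { toFun := fun y => ⟨fun c A => extendZero y.1 c (G.faceAt H.lines c (Sum.inl (H.rep A))), by
        refine ⟨fun A => mem_ker_incidence.1 y.2 _ (H.rep_mem_lines A), ?_, ?_⟩
        · have key : ∀ (v : V) (s : Bool) (A B : H.loops), (v, s) ∈ A.1 → (v, !s) ∈ B.1 →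
              extendZero y.1 (G.color v) (G.faceAt H.lines (G.color v) (Sum.inl (H.rep A))) =
              extendZero y.1 (G.color v) (G.faceAt H.lines (G.color v) (Sum.inl (H.rep B))) := by
            intro v s A B hA hB
            rw [extendZero_loop y.2 (H.rep_mem A) hA, extendZero_loop y.2 (H.rep_mem B) hB,
              ← extendZero_inr y.2 (mem_lines_of_mem hB), faceAt_strand,
              strand_color (G := G) (v, s)]
          rintro v A B (⟨hA, hB⟩ | ⟨hA, hB⟩)
          · exact key v false A B hA hB
          · exact key v true A B hA hB
        · intro h hh A hA
          beta_reduce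
          rw [extendZero_loop y.2 (H.rep_mem A) hA, faceAt_strand, strand_color]
          exact extendZero_open _ _ (mt onLine_inr_iff.1 hh.2)⟩
      map_add' := fun y y' => by
        ext c A
        exact extendZero_add _ _ _ _
      map_smul' := fun a y => by
        ext c A
        exact extendZero_smul _ _ _ _ }
  refine LinearMap.finrank_le_finrank_of_injective (f := φ) ?_
  rw [injective_iff_map_eq_zero]
  intro y hy
  ext f
  obtain ⟨h, hh, hf⟩ := exists_line_of_internalFace f
  have := congrFun (congrFun (congrArg Subtype.val hy) f.1) (H.loopOf ⟨h, hh⟩)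
  change extendZero y.1 f.1 (G.faceAt H.lines f.1 (Sum.inl (H.rep _))) = 0 at this
  rw [extendZero_loop y.2 (H.rep_mem _) (mem_loopOf ⟨h, hh⟩), ← hf, extendZero_internal] at this
  exact this

end ToLoop

/-! ### From functions on loop vertices back to the kernel. -/

section OfLoop

/-- The value of `u` at the loop vertex that bears the end `h` or, if `h` is not on `H`, the opposite
end of its wavy line; `a` if neither is on `H`. -/
noncomputable def nodeVal {α : Type*} (a : α) (u : H.loops → α) (h : HalfWavy V) : α := by
  classical
  exact if hh : h ∈ H.lines then u (H.loopOf ⟨h, hh⟩)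
    else if hh : (h.1, !h.2) ∈ H.lines then u (H.loopOf ⟨_, hh⟩) else a

variable {H}

theorem nodeVal_of_mem {α : Type*} {a : α} {u : H.loops → α} {h : HalfWavy V}
    {A : H.loops} (hA : h ∈ A.1) : H.nodeVal a u h = u A := by
  rw [nodeVal, dif_pos (mem_lines_of_mem hA), loopOf_eq _ hA]

theorem nodeVal_strand {α : Type*} {a : α} {u : H.loops → α} {c : Fin 6}
    (hu : ∀ v A B, H.Joins v A B → G.color v = c → u A = u B) (h : HalfWavy V) :
    H.nodeVal a u (G.strand c h) = H.nodeVal a u h := by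
  by_cases hc : c = G.color h.1
  · subst hc
    rw [strand_color]
    rcases h with ⟨v, s⟩
    by_cases h1 : (v, s) ∈ H.lines <;> by_cases h2 : (v, !s) ∈ H.lines
    · rw [nodeVal_of_mem (mem_loopOf ⟨_, h1⟩), nodeVal_of_mem (mem_loopOf ⟨_, h2⟩)]
      cases s
      · exact (hu v _ _ (Or.inl ⟨mem_loopOf ⟨_, h1⟩, mem_loopOf ⟨_, h2⟩⟩) rfl).symm
      · exact hu v _ _ (Or.inl ⟨mem_loopOf ⟨_, h2⟩, mem_loopOf ⟨_, h1⟩⟩) rfl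
    · simp [nodeVal, h1, h2]
    · simp [nodeVal, h1, h2]
    · simp [nodeVal, h1, h2]
  · rw [strand_of_ne hc]

theorem nodeVal_next {α : Type*} {a : α} {u : H.loops → α} {h h' : HalfWavy V}
    (hh : h ∈ H.lines) (hn : G.Next h h') : H.nodeVal a u h = H.nodeVal a u h' := by
  rw [nodeVal_of_mem (mem_loopOf ⟨h, hh⟩), nodeVal_of_mem
    (mem_loopOf ⟨h', mem_lines_of_next hn hh⟩), loopOf_next hh _ hn]

/-- A function on the ends that is constant along the arcs and along the strands of colour `c` gives
a function on the faces of colour `c`. -/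
def liftFace {α : Type*} (g : HalfWavy V → α) (c : Fin 6)
    (hn : ∀ h ∈ H.lines, ∀ h', G.Next h h' → g h = g h') (hs : ∀ h, g (G.strand c h) = g h) :
    G.Face H.lines c → α :=
  Quot.lift (Sum.elim g g) <| by
    rintro _ _ (⟨h, h', hS, hh⟩ | h)
    · exact hn h hS h' hh
    · exact (hs h).symm

open Classical in
variable (H) in
/-- As `nodeVal`, but zero on the ends that are not on `H`. -/
noncomputable def endVal (u : H.loops → ℚ) (h : HalfWavy V) : ℚ :=
  if hh : h ∈ H.lines then u (H.loopOf ⟨h, hh⟩) else 0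

theorem endVal_of_mem {u : H.loops → ℚ} {h : HalfWavy V} {A : H.loops} (hA : h ∈ A.1) :
    H.endVal u h = u A := by
  rw [endVal, dif_pos (mem_lines_of_mem hA), loopOf_eq _ hA]

theorem endVal_next {u : H.loops → ℚ} {h h' : HalfWavy V} (hh : h ∈ H.lines)
    (hn : G.Next h h') : H.endVal u h = H.endVal u h' := by
  rw [endVal_of_mem (mem_loopOf ⟨h, hh⟩), endVal_of_mem
    (mem_loopOf ⟨h', mem_lines_of_next hn hh⟩), loopOf_next hh _ hn]

/-- Only the special colour moves an end. Then either both ends are on `H` and the matching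
condition applies, or one is free and the vanishing condition agrees with the default value zero. -/
theorem endVal_strand {u : Fin 6 → H.loops → ℚ} (hu : u ∈ H.loopSpace) (c : Fin 6)
    (h : HalfWavy V) : H.endVal (u c) (G.strand c h) = H.endVal (u c) h := by
  by_cases hc : c = G.color h.1
  · subst hc
    rw [strand_color]
    rcases h with ⟨v, s⟩
    by_cases h1 : (v, s) ∈ H.lines <;> by_cases h2 : (v, !s) ∈ H.lines
    · rw [endVal_of_mem (mem_loopOf ⟨_, h1⟩), endVal_of_mem (mem_loopOf ⟨_, h2⟩)]
      cases s
      · exact (hu.2.1 v _ _ (Or.inl ⟨mem_loopOf ⟨_, h1⟩, mem_loopOf ⟨_, h2⟩⟩)).symm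
      · exact hu.2.1 v _ _ (Or.inl ⟨mem_loopOf ⟨_, h2⟩, mem_loopOf ⟨_, h1⟩⟩)
    · rw [endVal_of_mem (mem_loopOf ⟨_, h1⟩), endVal, dif_neg h2]
      exact (hu.2.2 (v, s) ⟨h1, h2⟩ _ (mem_loopOf ⟨_, h1⟩)).symm
    · rw [endVal_of_mem (mem_loopOf ⟨_, h2⟩), endVal, dif_neg h1]
      exact hu.2.2 (v, !s) ⟨h2, by simpa using h1⟩ _ (mem_loopOf ⟨_, h2⟩)
    · simp [endVal, h1, h2]
  · rw [strand_of_ne hc]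

/-- The function on faces given by an element of `loopSpace`. -/
noncomputable def faceVal (u : H.loopSpace) (c : Fin 6) : G.Face H.lines c → ℚ :=
  liftFace (H.endVal (u.1 c)) c (fun _ hh _ hn => endVal_next hh hn) (endVal_strand u.2 c)

/-- An open face reaches a node off the lines of `H`, where `endVal` is zero; so restricting to
internal faces and extending by zero loses nothing. -/
theorem extendZero_faceVal (u : H.loopSpace) (c : Fin 6) {h : HalfWavy V} {A : H.loops}
    (hA : h ∈ A.1) :
    extendZero (fun f => faceVal u f.1 f.2.1) c (G.faceAt H.lines c (Sum.inl h)) = u.1 c A := by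
  have h1 : faceVal u c (G.faceAt H.lines c (Sum.inl h)) = u.1 c A := endVal_of_mem hA
  by_cases hf : ∀ x : Node V, G.faceAt H.lines c x = G.faceAt H.lines c (Sum.inl h) →
      G.OnLine H.lines x
  · rw [extendZero, dif_pos hf]
    exact h1
  · rw [extendZero, dif_neg hf, ← h1]
    push Not at hf
    obtain ⟨x, hx, hx'⟩ := hf
    rw [← hx]
    rcases x with k | k
    · exact (show H.endVal (u.1 c) k = 0 from dif_neg hx').symm
    · exact (show H.endVal (u.1 c) k = 0 from dif_neg (mt onLine_inr_iff.2 hx')).symm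

theorem finrank_le_ker [Finite V] : Module.finrank ℚ H.loopSpace ≤
    Module.finrank ℚ (LinearMap.ker (G.incidence H.lines).mulVecLin) := by
  have hadd : ∀ (u u' : H.loops → ℚ) h, H.endVal (u + u') h = H.endVal u h + H.endVal u' h := by
    intro u u' h
    unfold endVal
    split_ifs <;> simp
  have hsmul : ∀ (a : ℚ) (u : H.loops → ℚ) h, H.endVal (a • u) h = a * H.endVal u h := by
    intro a u h
    unfold endVal
    split_ifs <;> simp
  let φ : H.loopSpace →ₗ[ℚ] LinearMap.ker (G.incidence H.lines).mulVecLin :=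
    { toFun := fun u => ⟨fun f => faceVal u f.1 f.2.1, by
        rw [mem_ker_incidence]
        intro l hl
        rw [← u.2.1 (H.loopOf ⟨l, hl⟩)]
        exact Finset.sum_congr rfl fun c _ => extendZero_faceVal u c (mem_loopOf ⟨l, hl⟩)⟩
      map_add' := fun u u' => by
        ext ⟨c, f, hf⟩
        obtain ⟨x, rfl⟩ := Quot.exists_rep f
        rcases x with h | h <;> exact hadd _ _ h
      map_smul' := fun a u => by
        ext ⟨c, f, hf⟩
        obtain ⟨x, rfl⟩ := Quot.exists_rep f
        rcases x with h | h <;> exact hsmul _ _ h }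
  refine LinearMap.finrank_le_finrank_of_injective (f := φ) ?_
  rw [injective_iff_map_eq_zero]
  intro u hu
  ext c A
  rw [← extendZero_faceVal u c (H.rep_mem A)]
  have h0 : (fun f : G.InternalFace H.lines => faceVal u f.1 f.2.1) = 0 :=
    congrArg Subtype.val hu
  rw [h0]
  unfold extendZero
  split_ifs <;> rfl

end OfLoop

/-- The divergence degree in terms of the numbers of wavy lines and of a space of functions on the
loop vertices. -/
theorem omega_eq [Finite V] : H.omega = Module.finrank ℚ H.loopSpace
    - 4 * (Nat.card H.internalWavy : ℤ) - 2 * H.numExternalWavy := by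
  rw [omega, divergenceDegree_eq, card_lines, le_antisymm H.finrank_ker_le finrank_le_ker]
  push_cast
  ring

end PISubgraph

end FeynmanGraph

/-! ### Linear algebra -/

section LinearAlgebra

theorem finrank_le_sum_card {K Λ : Type*} [Finite K] [Fintype Λ] (W : Submodule ℚ (K → Λ → ℚ))
    (D : Λ → Finset K) (hD : ∀ u ∈ W, (∀ A, ∀ c ∈ D A, u c A = 0) → u = 0) :
    Module.finrank ℚ W ≤ ∑ A, (D A).card := by
  let φ : W →ₗ[ℚ] ((Σ A : Λ, D A) → ℚ) :=
    { toFun := fun u p => u.1 p.2.1 p.1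
      map_add' := fun u u' => rfl
      map_smul' := fun a u => rfl }
  have h := LinearMap.finrank_le_finrank_of_injective (f := φ) (by
    rw [injective_iff_map_eq_zero]
    exact fun u hu => Subtype.ext (hD u u.2 fun A c hc => congrFun hu ⟨A, c, hc⟩))
  simpa [Module.finrank_fintype_fun_eq_card] using h

/-- A bound on the dimension of a space of families of colour-wise functions that sum to zero over
the colours, where at each point one colour is determined by points of lower rank. -/
theorem finrank_le_of_parent {K Λ : Type*} [Fintype K] [DecidableEq K] [Fintype Λ]
    (W : Submodule ℚ (K → Λ → ℚ)) (r : Λ → ℕ) (pc : Λ → K) (Z : Λ → Finset K)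
    (hsum : ∀ u ∈ W, ∀ A, ∑ c, u c A = 0) (hZ : ∀ u ∈ W, ∀ A, ∀ c ∈ Z A, u c A = 0)
    (hpc : ∀ u ∈ W, ∀ A, (∀ B, r B < r A → ∀ c, u c B = 0) → u (pc A) A = 0)
    (hlt : ∀ A, (insert (pc A) (Z A)).card < Fintype.card K) :
    Module.finrank ℚ W ≤ ∑ A, (Fintype.card K - 1 - (insert (pc A) (Z A)).card) := by
  -- The spare colour chosen at each point is the one whose value is recovered from the zero sum;
  -- this accounts for the `- 1` in the bound.
  have hc : ∀ A, ∃ c, c ∉ insert (pc A) (Z A) := fun A => by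
    by_contra! h
    exact (hlt A).ne (Finset.card_eq_iff_eq_univ _ |>.2 (Finset.eq_univ_iff_forall.2 h))
  choose c' hc' using hc
  refine (finrank_le_sum_card W (fun A => (insert (c' A) (insert (pc A) (Z A)))ᶜ) ?_).trans
    (Finset.sum_le_sum fun A _ => ?_)
  · intro u hu hD
    have key : ∀ n A, r A = n → ∀ c, u c A = 0 := by
      intro n
      induction n using Nat.strong_induction_on with
      | _ n ih =>
        intro A hA
        have hp : u (pc A) A = 0 := hpc u hu A fun B hB => ih _ (hA ▸ hB) B rfl
        have h0 : ∀ c, c ≠ c' A → u c A = 0 := by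
          intro c hcc
          by_cases h1 : c = pc A
          · exact h1 ▸ hp
          by_cases h2 : c ∈ Z A
          · exact hZ u hu A c h2
          · exact hD A c (by simp [hcc, h1, h2])
        intro c
        by_cases hcc : c = c' A
        · have := hsum u hu A
          rwa [Finset.sum_eq_single (c' A) (fun b _ hb => h0 b hb) (by simp), ← hcc] at this
        · exact h0 c hcc
    ext c A
    exact key _ A rfl c
  · rw [Finset.card_compl, Finset.card_insert_of_notMem (hc' A)]
    omega

/-! ### Difference maps and flows on trees. -/

variable {Λ N : Type*} [Fintype Λ] [Fintype N]

/-- The differences of a function along the edges of a graph. -/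
def edgeDiff (s t : N → Λ) : (Λ → ℚ) →ₗ[ℚ] (N → ℚ) where
  toFun u v := u (s v) - u (t v)
  map_add' u u' := by ext v; simp; ring
  map_smul' a u := by ext v; simp; ring

/-- Connectedness leaves only constants in the kernel, so the rank is at least the number of nodes
minus one, which is the number of edges. -/
theorem edgeDiff_surjective {s t : N → Λ}
    (hconn : ∀ u : Λ → ℚ, (∀ v, u (s v) = u (t v)) → ∀ A B, u A = u B)
    (hcard : Fintype.card Λ = Fintype.card N + 1) : Function.Surjective (edgeDiff s t) := by
  have hker : Module.finrank ℚ (LinearMap.ker (edgeDiff s t)) ≤ 1 := by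
    obtain ⟨A⟩ : Nonempty Λ := Fintype.card_pos_iff.1 (by omega)
    let φ : LinearMap.ker (edgeDiff s t) →ₗ[ℚ] ℚ :=
      { toFun := fun u => u.1 A
        map_add' := fun u u' => rfl
        map_smul' := fun a u => rfl }
    have h := LinearMap.finrank_le_finrank_of_injective (f := φ) (by
      rw [injective_iff_map_eq_zero]
      intro u hu
      ext B
      rw [hconn u.1 (fun v => sub_eq_zero.1 (congrFun u.2 v)) B A]
      exact hu)
    simpa using h
  have h := LinearMap.finrank_range_add_finrank_ker (edgeDiff s t)
  rw [Module.finrank_fintype_fun_eq_card] at h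
  rw [← LinearMap.range_eq_top]
  refine Submodule.eq_top_of_finrank_eq (le_antisymm (Submodule.finrank_le _) ?_)
  rw [Module.finrank_fintype_fun_eq_card]
  omega

omit [Fintype Λ] in
/-- A conserved flow on a tree vanishes. -/
theorem flow_eq_zero {s t : N → Λ} (hs : Function.Surjective (edgeDiff s t)) {d : N → ℚ}
    (hd : ∀ u : Λ → ℚ, ∑ v, d v * (u (s v) - u (t v)) = 0) : d = 0 := by
  obtain ⟨u, hu⟩ := hs d
  have h : ∑ v, d v * d v = 0 := by
    rw [← hd u]
    exact Finset.sum_congr rfl fun v _ => congrArg _ (congrFun hu v).symm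
  ext v
  exact mul_self_eq_zero.1
    ((Finset.sum_eq_zero_iff_of_nonneg fun v _ => mul_self_nonneg (d v)).1 h v (Finset.mem_univ v))

/-- The functions on the nodes of a tree that are constant along the edges in `P`. -/
def constOn (s t : N → Λ) (P : N → Prop) : Submodule ℚ (Λ → ℚ) where
  carrier := {u | ∀ v, P v → u (s v) = u (t v)}
  zero_mem' := by simp
  add_mem' := fun h h' v hv => by simp [h v hv, h' v hv]
  smul_mem' := fun a u h v hv => by simp [h v hv]

/-- Since the differences along the edges are arbitrary, the conditions imposed by the edges in `P`
are independent. -/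
theorem finrank_constOn {s t : N → Λ} (hs : Function.Surjective (edgeDiff s t)) (P : N → Prop) :
    Module.finrank ℚ (constOn s t P) + Nat.card {v // P v} = Fintype.card Λ := by
  classical
  let φ : (Λ → ℚ) →ₗ[ℚ] ({v // P v} → ℚ) :=
    (LinearMap.funLeft ℚ ℚ (Subtype.val : {v // P v} → N)).comp (edgeDiff s t)
  have hφ : Function.Surjective φ :=
    (LinearMap.funLeft_surjective_of_injective ℚ ℚ _ Subtype.val_injective).comp hs
  have hk : LinearMap.ker φ = constOn s t P := by
    ext u
    rw [LinearMap.mem_ker, funext_iff]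
    exact ⟨fun h v hv => sub_eq_zero.1 (h ⟨v, hv⟩), fun h v => sub_eq_zero.2 (h v.1 v.2)⟩
  have h := LinearMap.finrank_range_add_finrank_ker φ
  rw [LinearMap.range_eq_top.2 hφ, finrank_top, hk, Module.finrank_fintype_fun_eq_card,
    Module.finrank_fintype_fun_eq_card, ← Nat.card_eq_fintype_card] at h
  omega

theorem card_quot_eq_finrank {α : Type*} [Finite α] (r : α → α → Prop) :
    Nat.card (Quot r) = Module.finrank ℚ (Quot r → ℚ) := by
  have : Fintype (Quot r) := Fintype.ofFinite _
  rw [Module.finrank_fintype_fun_eq_card, Nat.card_eq_fintype_card]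

end LinearAlgebra

namespace FeynmanGraph.PISubgraph

variable {V : Type*} {G : FeynmanGraph V} (H : G.PISubgraph)

/-! ### Trees -/

/-- The internal wavy lines that are not self-loops. -/
def properWavy : Set V :=
  {v | ∃ A B : H.loops, A ≠ B ∧ (v, false) ∈ A.1 ∧ (v, true) ∈ B.1}

theorem properWavy_subset : H.properWavy ⊆ H.internalWavy := by
  rintro v ⟨A, B, -, hA, hB⟩
  exact ⟨mem_lines_of_mem hA, mem_lines_of_mem hB⟩

variable {H} in
theorem Joins.symm {v : V} {A B : H.loops} (h : H.Joins v A B) : H.Joins v B A :=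
  (Or.symm h).imp And.symm And.symm

variable {H} in
theorem Joins.eq_or_eq {v : V} {A B A' B' : H.loops} (h : H.Joins v A B) (h' : H.Joins v A' B') :
    s(A, B) = s(A', B') := by
  have key : ∀ {h : HalfWavy V} {A B : H.loops}, h ∈ A.1 → h ∈ B.1 → A = B :=
    fun ha hb => Subtype.ext (loop_unique (Subtype.property _) (Subtype.property _) ha hb)
  rw [Sym2.eq_iff]
  rcases h with ⟨h1, h2⟩ | ⟨h1, h2⟩ <;> rcases h' with ⟨h3, h4⟩ | ⟨h3, h4⟩
  · exact Or.inl ⟨key h1 h3, key h2 h4⟩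
  · exact Or.inr ⟨key h1 h4, key h2 h3⟩
  · exact Or.inr ⟨key h1 h4, key h2 h3⟩
  · exact Or.inl ⟨key h1 h3, key h2 h4⟩

/-- The edge of the graph of loop vertices given by a wavy line. -/
noncomputable def edgeOf (v : H.properWavy) : H.simpleGraph.edgeSet :=
  ⟨s(v.2.choose, v.2.choose_spec.choose), v.2.choose_spec.choose_spec.1, v.1,
    Or.inl v.2.choose_spec.choose_spec.2⟩

variable {H} in
theorem edgeOf_eq {v : H.properWavy} {A B : H.loops} (h : H.Joins v.1 A B) :
    (H.edgeOf v).1 = s(A, B) :=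
  Joins.eq_or_eq (Or.inl v.2.choose_spec.choose_spec.2) h

variable {H} in
theorem mem_properWavy_of {v : V} {A B : H.loops} (hAB : A ≠ B) (h : H.Joins v A B) :
    v ∈ H.properWavy := by
  rcases h with ⟨h1, h2⟩ | ⟨h1, h2⟩
  · exact ⟨A, B, hAB, h1, h2⟩
  · exact ⟨B, A, hAB.symm, h2, h1⟩

theorem edgeOf_surjective : Function.Surjective H.edgeOf := by
  rintro ⟨e, he⟩
  induction e using Sym2.ind with
  | _ A B =>
    obtain ⟨hAB, v, hv⟩ := he
    exact ⟨⟨v, mem_properWavy_of hAB hv⟩, Subtype.ext (edgeOf_eq hv)⟩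

theorem card_loops_le [Finite V] (hc : H.Connected) :
    Nat.card H.loops ≤ Nat.card H.internalWavy + 1 :=
  hc.card_vert_le_card_edgeSet_add_one.trans (Nat.add_le_add_right
    ((Nat.card_le_card_of_surjective _ H.edgeOf_surjective).trans
      (Nat.card_mono (Set.toFinite _) H.properWavy_subset)) 1)

/-- Edges of the simple graph are at most as many as proper wavy lines, and these at most as many as
internal ones. For a connected graph, equality of the internal count with n - 1 makes both
inequalities sharp, which excludes multiple edges and self-loops. -/
theorem isTree_iff [Finite V] :
    H.IsTree ↔ H.Connected ∧ Nat.card H.internalWavy + 1 = Nat.card H.loops := by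
  have hle := Nat.card_mono (Set.toFinite _) H.properWavy_subset
  have hle' := Nat.card_le_card_of_surjective _ H.edgeOf_surjective
  constructor
  · rintro ⟨ht, h1, h2⟩
    refine ⟨ht.connected, ?_⟩
    rw [← (SimpleGraph.isTree_iff_connected_and_card.1 ht).2]
    have hsub : H.internalWavy = H.properWavy := by
      refine (Set.Subset.antisymm H.properWavy_subset fun v hv => ?_).symm
      refine ⟨H.loopOf ⟨_, hv.1⟩, H.loopOf ⟨_, hv.2⟩, fun h => h1 v (H.loopOf ⟨_, hv.1⟩) ?_,
        mem_loopOf ⟨_, hv.1⟩, mem_loopOf ⟨_, hv.2⟩⟩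
      exact Or.inl ⟨mem_loopOf ⟨_, hv.1⟩, h ▸ mem_loopOf ⟨_, hv.2⟩⟩
    rw [hsub]
    refine congrArg (· + 1) (Nat.card_congr (Equiv.ofBijective H.edgeOf ⟨?_, H.edgeOf_surjective⟩))
    intro v w hvw
    obtain ⟨A, B, -, hv⟩ := v.2
    obtain ⟨A', B', -, hw⟩ := w.2
    have := congrArg Subtype.val hvw
    rw [edgeOf_eq (Or.inl hv), edgeOf_eq (Or.inl hw), Sym2.eq_iff] at this
    rcases this with ⟨rfl, rfl⟩ | ⟨rfl, rfl⟩
    · exact Subtype.ext (h2 _ _ _ _ (Or.inl hv) (Or.inl hw))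
    · exact Subtype.ext (h2 _ _ _ _ (Or.inl hv) (Or.inr hw.symm))
  · rintro ⟨hc, hn⟩
    have h3 := SimpleGraph.Connected.card_vert_le_card_edgeSet_add_one hc
    have hE : Nat.card H.properWavy = Nat.card H.simpleGraph.edgeSet := by omega
    have hinj : Function.Injective H.edgeOf :=
      ((Nat.bijective_iff_surjective_and_card _).2 ⟨H.edgeOf_surjective, hE⟩).1
    have hsub : H.properWavy = H.internalWavy := by
      refine Set.eq_of_subset_of_ncard_le H.properWavy_subset ?_ (Set.toFinite _)
      rw [← Nat.card_coe_set_eq, ← Nat.card_coe_set_eq]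
      omega
    have hloop : ∀ v A, ¬ H.Joins v A A := by
      intro v A hv
      have hv' : v ∈ H.properWavy := by
        rw [hsub]
        rcases hv with ⟨h1, h2⟩ | ⟨h1, h2⟩
        · exact ⟨mem_lines_of_mem h1, mem_lines_of_mem h2⟩
        · exact ⟨mem_lines_of_mem h2, mem_lines_of_mem h1⟩
      obtain ⟨B, C, hBC, h⟩ := hv'
      have := Joins.eq_or_eq hv (Or.inl h)
      rw [Sym2.eq_iff] at this
      rcases this with ⟨rfl, rfl⟩ | ⟨rfl, rfl⟩ <;> exact hBC rfl
    refine ⟨SimpleGraph.isTree_iff_connected_and_card.2 ⟨hc, by omega⟩, hloop, ?_⟩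
    intro v w A B hv hw
    have hAB : A ≠ B := fun h => hloop v A (by rw [← h] at hv; exact hv)
    have : H.edgeOf ⟨v, mem_properWavy_of hAB hv⟩ = H.edgeOf ⟨w, mem_properWavy_of hAB hw⟩ :=
      Subtype.ext ((edgeOf_eq hv).trans (edgeOf_eq hw).symm)
    exact congrArg Subtype.val (hinj this)

end FeynmanGraph.PISubgraph

namespace FeynmanGraph.PISubgraph

variable {V : Type*} {G : FeynmanGraph V} (H : G.PISubgraph)

/-! ### The dimension of the space of functions on loop vertices -/

/-- Connection of loop vertices through wavy lines of colour `c`. -/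
def ColorConn (c : Fin 6) : H.loops → H.loops → Prop :=
  Relation.ReflTransGen fun A B => ∃ v, H.Joins v A B ∧ G.color v = c

variable {H}

theorem ColorConn.eq {α : Type*} {c : Fin 6} {A B : H.loops} (h : H.ColorConn c A B)
    {u : H.loops → α} (hu : ∀ v A B, H.Joins v A B → G.color v = c → u A = u B) : u A = u B := by
  induction h with
  | refl => rfl
  | tail _ h ih =>
    obtain ⟨v, hv, hvc⟩ := h
    exact ih.trans (hu v _ _ hv hvc)

theorem ColorConn.symm {c : Fin 6} {A B : H.loops} (h : H.ColorConn c A B) : H.ColorConn c B A := by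
  induction h with
  | refl => exact Relation.ReflTransGen.refl
  | tail _ h ih =>
    obtain ⟨v, hv, hvc⟩ := h
    exact Relation.ReflTransGen.head ⟨v, hv.symm, hvc⟩ ih

/-- The parent is the next loop vertex on a geodesic to the root. -/
theorem exists_parent (hc : H.Connected) {A A₀ : H.loops} (hA : A ≠ A₀) :
    ∃ B v, H.Joins v A B ∧ H.simpleGraph.dist B A₀ < H.simpleGraph.dist A A₀ := by
  have key : ∀ {C} (p : H.simpleGraph.Walk A C), A ≠ C →
      ∃ B v, H.Joins v A B ∧ H.simpleGraph.dist B C < p.length := by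
    intro C p hA
    cases p with
    | nil => exact absurd rfl hA
    | cons hadj q =>
      obtain ⟨-, v, hv⟩ := hadj
      exact ⟨_, v, hv, Nat.lt_succ_of_le (SimpleGraph.dist_le q)⟩
  obtain ⟨p, hp⟩ := (hc.preconnected A A₀).exists_walk_length_eq_dist
  exact hp ▸ key p hA

/-! ### Upper bound on the dimension, and the case of equality. -/

section Upper

variable {h₀ : HalfWavy V} {A₀ : H.loops}

theorem exists_parentColor (hc : H.Connected) (h₀ : HalfWavy V) (A₀ : H.loops) :
    ∃ pc : H.loops → Fin 6, ∀ A, (A = A₀ ∧ pc A = G.color h₀.1) ∨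
      ∃ B v, H.Joins v A B ∧ H.simpleGraph.dist B A₀ < H.simpleGraph.dist A A₀ ∧
        pc A = G.color v := by
  have : ∀ A : H.loops, ∃ c : Fin 6, (A = A₀ ∧ c = G.color h₀.1) ∨
      ∃ B v, H.Joins v A B ∧ H.simpleGraph.dist B A₀ < H.simpleGraph.dist A A₀ ∧
        c = G.color v := by
    intro A
    by_cases hA : A = A₀
    · exact ⟨_, Or.inl ⟨hA, rfl⟩⟩
    · obtain ⟨B, v, hv, hlt⟩ := exists_parent hc hA
      exact ⟨_, Or.inr ⟨B, v, hv, hlt, rfl⟩⟩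
  choose pc hpc using this
  exact ⟨pc, hpc⟩

theorem parentColor_eq_zero (hh₀ : h₀ ∈ H.externalWavy) (hA₀ : h₀ ∈ A₀.1) {pc : H.loops → Fin 6}
    (hpc : ∀ A, (A = A₀ ∧ pc A = G.color h₀.1) ∨
      ∃ B v, H.Joins v A B ∧ H.simpleGraph.dist B A₀ < H.simpleGraph.dist A A₀ ∧
        pc A = G.color v) {u : Fin 6 → H.loops → ℚ} (hu : u ∈ H.loopSpace) (A : H.loops)
    (ih : ∀ B, H.simpleGraph.dist B A₀ < H.simpleGraph.dist A A₀ → ∀ c, u c B = 0) :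
    u (pc A) A = 0 := by
  rcases hpc A with ⟨rfl, h⟩ | ⟨B, v, hv, hlt, h⟩
  · rw [h]
    exact hu.2.2 _ hh₀ _ hA₀
  · rw [h, hu.2.1 v _ _ hv]
    exact ih B hlt _

theorem finrank_loopSpace_le [Finite V] (hc : H.Connected) (hh₀ : h₀ ∈ H.externalWavy) (hA₀ : h₀ ∈ A₀.1) :
    Module.finrank ℚ H.loopSpace ≤ 4 * Nat.card H.loops := by
  have := Fintype.ofFinite H.loops
  obtain ⟨pc, hpc⟩ := exists_parentColor hc h₀ A₀
  refine (finrank_le_of_parent H.loopSpace (fun A => H.simpleGraph.dist A A₀) pc (fun _ => ∅)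
    (fun u hu => hu.1) (by simp) (fun u hu => parentColor_eq_zero hh₀ hA₀ hpc hu) (by simp)).trans ?_
  simp [mul_comm]

/-- If the space has its maximal dimension, the values that vanish identically are those which are
tied to the external wavy line `h₀` by wavy lines of its colour. -/
theorem colorConn_of_eq_zero [Finite V] (hc : H.Connected) (hh₀ : h₀ ∈ H.externalWavy) (hA₀ : h₀ ∈ A₀.1)
    (hdim : 4 * Nat.card H.loops ≤ Module.finrank ℚ H.loopSpace) {c : Fin 6} {A : H.loops}
    (hz : ∀ u ∈ H.loopSpace, u c A = 0) : c = G.color h₀.1 ∧ H.ColorConn c A A₀ := by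
  classical
  have := Fintype.ofFinite H.loops
  obtain ⟨pc, hpc⟩ := exists_parentColor hc h₀ A₀
  -- If a colour other than the parent colour also vanished identically at `B`, only three values
  -- would be free there and the dimension would drop below its maximum.
  have hB : ∀ B : H.loops, (∀ u ∈ H.loopSpace, u c B = 0) → c = pc B := by
    intro B hB
    by_contra hne
    have hcard : ∀ A, (insert (pc A) (if A = B then {c} else ∅ : Finset (Fin 6))).card =
        if A = B then 2 else 1 := by
      intro A
      split_ifs with h
      · subst h
        exact Finset.card_pair (Ne.symm hne)
      · simp
    have hle := finrank_le_of_parent H.loopSpace (fun A => H.simpleGraph.dist A A₀) pc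
      (fun A => if A = B then {c} else ∅) (fun u hu => hu.1)
      (fun u hu A c' hc' => by
        split_ifs at hc' with h
        · rw [Finset.mem_singleton.1 hc', h]
          exact hB u hu
        · simp at hc')
      (fun u hu => parentColor_eq_zero hh₀ hA₀ hpc hu)
      (fun A => by rw [hcard]; split_ifs <;> simp)
    have hlt : ∑ A : H.loops, (Fintype.card (Fin 6) - 1 -
        (insert (pc A) (if A = B then {c} else ∅ : Finset (Fin 6))).card) < ∑ _A : H.loops, 4 := by
      refine Finset.sum_lt_sum (fun A _ => ?_) ⟨B, Finset.mem_univ _, ?_⟩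
      · rw [hcard]
        split_ifs <;> simp
      · rw [hcard]
        simp
    rw [Finset.sum_const, Finset.card_univ, smul_eq_mul] at hlt
    rw [Nat.card_eq_fintype_card] at hdim
    omega
  -- Identical vanishing propagates to the parent through a wavy line of colour `c`, so the descent
  -- to the root runs along this colour only.
  have key : ∀ n (A : H.loops), H.simpleGraph.dist A A₀ = n → (∀ u ∈ H.loopSpace, u c A = 0) →
      c = G.color h₀.1 ∧ H.ColorConn c A A₀ := by
    intro n
    induction n using Nat.strong_induction_on with
    | _ n ih =>
      intro A hA hz
      have hcA := hB A hz
      rcases hpc A with ⟨rfl, h⟩ | ⟨B, v, hv, hlt, h⟩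
      · exact ⟨hcA.trans h, Relation.ReflTransGen.refl⟩
      · have hcv : G.color v = c := (hcA.trans h).symm
        obtain ⟨h1, h2⟩ := ih _ (hA ▸ hlt) B rfl fun u hu => by
          rw [← hz u hu, ← hcv]
          exact (hu.2.1 v A B hv).symm
        exact ⟨h1, Relation.ReflTransGen.head ⟨v, hv, hcv⟩ h2⟩
  exact key _ A rfl hz

end Upper

/-- There are 6n unknowns and n + (n - 1) + 1 equations: sums, wavy lines of the tree, and a single
external condition at `A₀`, which implies all the others by transport along its colour. -/
theorem le_finrank_loopSpace [Finite V] (ht : H.IsTree) {h₀ : HalfWavy V} {A₀ : H.loops}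
    (hext : ∀ h ∈ H.externalWavy, ∀ A : H.loops, h ∈ A.1 →
      G.color h.1 = G.color h₀.1 ∧ H.ColorConn (G.color h₀.1) A₀ A) :
    4 * Nat.card H.loops ≤ Module.finrank ℚ H.loopSpace := by
  have := Fintype.ofFinite H.loops
  have := Fintype.ofFinite H.internalWavy
  let Φ : (Fin 6 → H.loops → ℚ) →ₗ[ℚ] (H.loops → ℚ) × (H.internalWavy → ℚ) × ℚ :=
    { toFun := fun u => (fun A => ∑ c, u c A,
        fun v => u (G.color v.1) (H.loopOf ⟨_, v.2.1⟩) - u (G.color v.1) (H.loopOf ⟨_, v.2.2⟩),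
        u (G.color h₀.1) A₀)
      map_add' := fun u u' => by
        ext
        · simp [Finset.sum_add_distrib]
        · simp; ring
        · simp
      map_smul' := fun a u => by
        ext
        · simp [Finset.mul_sum]
        · simp; ring
        · simp }
  have hker : LinearMap.ker Φ ≤ H.loopSpace := by
    intro u hu
    have h1 : ∀ A, ∑ c, u c A = 0 := congrFun (congrArg Prod.fst hu)
    have h2 : ∀ v : H.internalWavy, u (G.color v.1) (H.loopOf ⟨_, v.2.1⟩) -
        u (G.color v.1) (H.loopOf ⟨_, v.2.2⟩) = 0 :=
      congrFun (congrArg (fun p => p.2.1) hu)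
    have h3 : u (G.color h₀.1) A₀ = 0 := congrArg (fun p => p.2.2) hu
    have key : ∀ v (A B : H.loops), (v, false) ∈ A.1 → (v, true) ∈ B.1 →
        u (G.color v) A = u (G.color v) B := by
      intro v A B hA hB
      have := h2 ⟨v, mem_lines_of_mem hA, mem_lines_of_mem hB⟩
      rw [loopOf_eq _ hA, loopOf_eq _ hB] at this
      exact sub_eq_zero.1 this
    have h2' : ∀ v A B, H.Joins v A B → u (G.color v) A = u (G.color v) B := by
      rintro v A B (⟨hA, hB⟩ | ⟨hA, hB⟩)
      · exact key v A B hA hB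
      · exact (key v B A hB hA).symm
    refine ⟨h1, h2', fun h hh A hA => ?_⟩
    obtain ⟨hcol, hconn⟩ := hext h hh A hA
    rw [hcol, ← h3]
    exact (hconn.eq fun v A B hv hvc => by rw [← hvc]; exact h2' v A B hv).symm
  have h := LinearMap.finrank_range_add_finrank_ker Φ
  have hr := Submodule.finrank_le (LinearMap.range Φ)
  have hk := Submodule.finrank_mono hker
  have hn := (H.isTree_iff.1 ht).2
  rw [Nat.card_eq_fintype_card, Nat.card_eq_fintype_card] at hn
  simp only [Module.finrank_prod, Module.finrank_fintype_fun_eq_card, Module.finrank_self,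
    Module.finrank_pi_fintype, Finset.sum_const, Finset.card_univ, Fintype.card_fin,
    smul_eq_mul] at h hr
  rw [Nat.card_eq_fintype_card]
  omega

/-- Being tied to a given loop vertex by wavy lines of colour c is invariant along arcs and strands
of that colour, hence is a property of faces. -/
theorem colorConn_of_sameStrand {h h' : HalfWavy V} {A B : H.loops} (hA : h ∈ A.1) (hB : h' ∈ B.1)
    (hs : H.SameStrand h h') : H.ColorConn (G.color h.1) A B := by
  let c := G.color h.1
  have key : ∀ {h h' : HalfWavy V} {A B : H.loops}, h ∈ A.1 → h' ∈ B.1 →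
      G.faceAt H.lines c (Sum.inl h) = G.faceAt H.lines c (Sum.inr h') → H.ColorConn c A B := by
    intro h h' A B hA hB hf
    have hu : ∀ v A' B', H.Joins v A' B' → G.color v = c → H.ColorConn c A A' = H.ColorConn c A B' :=
      fun v A' B' hv hvc => propext ⟨fun h => h.tail ⟨v, hv, hvc⟩, fun h => h.tail ⟨v, hv.symm, hvc⟩⟩
    have := congrArg (liftFace (H.nodeVal True (H.ColorConn c A)) c
      (fun _ hh _ hn => nodeVal_next hh hn) (nodeVal_strand hu)) hf
    change H.nodeVal True (H.ColorConn c A) h = H.nodeVal True (H.ColorConn c A) h' at this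
    rw [nodeVal_of_mem hA, nodeVal_of_mem hB] at this
    rw [← this]
    exact Relation.ReflTransGen.refl
  rcases hs.2 with hf | hf
  · exact key hA hB hf
  · exact (key hB hA hf).symm

end FeynmanGraph.PISubgraph

namespace FeynmanGraph.PISubgraph

variable {V : Type*} {G : FeynmanGraph V} (H : G.PISubgraph)

/-! ### The closure of a subgraph -/

/-- The end `s` of a wavy line of `H`. -/
def endAt (v : G.vertices H.lines) (s : Bool) : G.Ends H.lines := ⟨(v.1, s), v.2⟩

open Classical in
/-- The arcs of the closure: those of `H`, and one arc from each free end to itself. -/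
noncomputable def closureFun (h : G.Ends H.lines) : G.Ends H.lines :=
  if hh : h.1 ∈ H.lines then
    ⟨(H.exists_next hh).choose, mem_vertices_of_mem (H.exists_next hh).choose_spec.1⟩
  else h

open Classical in
/-- The loop vertices of the closure: those of `H`, and one for each free end. -/
noncomputable def label (h : G.Ends H.lines) : H.loops ⊕ H.Free :=
  if hh : h.1 ∈ H.lines then Sum.inl (H.loopOf ⟨h.1, hh⟩) else Sum.inr ⟨h.1, h.2, hh⟩

variable {H}

theorem closureFun_next {h : G.Ends H.lines} (hh : h.1 ∈ H.lines) :
    G.Next h.1 (H.closureFun h).1 := by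
  rw [closureFun, dif_pos hh]
  exact (H.exists_next hh).choose_spec.2

theorem closureFun_of_not_mem {h : G.Ends H.lines} (hh : h.1 ∉ H.lines) : H.closureFun h = h := by
  rw [closureFun, dif_neg hh]

theorem closureFun_mem_iff {h : G.Ends H.lines} : (H.closureFun h).1 ∈ H.lines ↔ h.1 ∈ H.lines := by
  by_cases hh : h.1 ∈ H.lines
  · exact iff_of_true (mem_lines_of_next (closureFun_next hh) hh) hh
  · rw [closureFun_of_not_mem hh]

theorem closureFun_injective : Function.Injective H.closureFun := by
  intro h h' he
  by_cases hh : h.1 ∈ H.lines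
  · have hh' : h'.1 ∈ H.lines := by rwa [← closureFun_mem_iff, ← he, closureFun_mem_iff]
    have hn := closureFun_next hh
    rw [he] at hn
    exact Subtype.ext (hn.left_unique (closureFun_next hh'))
  · have hh' : h'.1 ∉ H.lines := by rwa [← closureFun_mem_iff, ← he, closureFun_mem_iff]
    rwa [closureFun_of_not_mem hh, closureFun_of_not_mem hh'] at he

variable (H) in
/-- The arcs of the closure, as a permutation of the ends. -/
noncomputable def closure [Finite V] : G.Ends H.lines ≃ G.Ends H.lines :=
  Equiv.ofBijective H.closureFun (Finite.injective_iff_bijective.1 closureFun_injective)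

theorem label_of_mem {h : G.Ends H.lines} {A : H.loops} (hA : h.1 ∈ A.1) :
    H.label h = Sum.inl A := by
  rw [label, dif_pos (mem_lines_of_mem hA), loopOf_eq _ hA]

theorem label_free (h : H.Free) : H.label ⟨h.1, h.2.1⟩ = Sum.inr h := dif_neg h.2.2

theorem label_closureFun (h : G.Ends H.lines) : H.label (H.closureFun h) = H.label h := by
  by_cases hh : h.1 ∈ H.lines
  · rw [label_of_mem (mem_loopOf ⟨h.1, hh⟩),
      label_of_mem (mem_loop_of_next (H.loopOf _).2 (closureFun_next hh) (mem_loopOf ⟨h.1, hh⟩))]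
  · rw [closureFun_of_not_mem hh]

variable (H) in
/-- An end of the closure on a given loop vertex. -/
noncomputable def labelRep : H.loops ⊕ H.Free → G.Ends H.lines :=
  Sum.elim (fun A => ⟨H.rep A, mem_vertices_of_mem (H.rep_mem_lines A)⟩) fun h => ⟨h.1, h.2.1⟩

theorem label_labelRep (A : H.loops ⊕ H.Free) : H.label (H.labelRep A) = A := by
  rcases A with A | h
  · exact label_of_mem (H.rep_mem A)
  · exact label_free h

theorem eq_labelRep {α : Type*} {f : G.Ends H.lines → α} (hf : ∀ h, f (H.closureFun h) = f h)
    (h : G.Ends H.lines) : f (H.labelRep (H.label h)) = f h := by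
  classical
  by_cases hh : h.1 ∈ H.lines
  -- `Option` extends `f` to all ends, as `eq_of_mem_loop` needs, without requiring a default value
  -- in `α`.
  · let g : HalfWavy V → Option α := fun k =>
      if hk : k.1 ∈ G.vertices H.lines then some (f ⟨k, hk⟩) else none
    have hg : ∀ k : G.Ends H.lines, g k.1 = some (f k) := fun k => dif_pos k.2
    have hgn : ∀ k ∈ H.lines, ∀ k', G.Next k k' → g k = g k' := by
      intro k hk k' hn
      have h1 := hf ⟨k, mem_vertices_of_mem hk⟩
      have h2 := closureFun_next (h := ⟨k, mem_vertices_of_mem hk⟩) hk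
      rw [hg ⟨k, mem_vertices_of_mem hk⟩, hn.right_unique h2, hg, h1]
    rw [label_of_mem (mem_loopOf ⟨h.1, hh⟩)]
    have := eq_of_mem_loop hgn (H.rep_mem _) (mem_loopOf ⟨h.1, hh⟩)
    rw [hg h] at this
    exact Option.some_injective _ ((hg _).symm.trans this)
  · have : H.label h = Sum.inr ⟨h.1, h.2, hh⟩ := label_free ⟨h.1, h.2, hh⟩
    rw [this]
    rfl

theorem eq_of_label {α : Type*} (hc : H.Connected) {u : H.loops ⊕ H.Free → α}
    (hu : ∀ v, u (H.label (H.endAt v true)) = u (H.label (H.endAt v false)))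
    (A B : H.loops ⊕ H.Free) : u A = u B := by
  have hu' : ∀ (h : HalfWavy V) (h1 : h.1 ∈ G.vertices H.lines),
      u (H.label ⟨h, h1⟩) = u (H.label ⟨(h.1, !h.2), h1⟩) := by
    rintro ⟨v, _ | _⟩ h1
    · exact (hu ⟨v, h1⟩).symm
    · exact hu ⟨v, h1⟩
  have hj : ∀ (h : HalfWavy V) (A B : H.loops), h ∈ A.1 → (h.1, !h.2) ∈ B.1 →
      u (Sum.inl A) = u (Sum.inl B) := by
    intro h A B hA hB
    have hv := mem_vertices_of_mem (mem_lines_of_mem hA)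
    have h3 := hu' h hv
    rwa [label_of_mem (h := ⟨h, hv⟩) hA, label_of_mem (h := ⟨(h.1, !h.2), hv⟩) hB] at h3
  have hl : ∀ A B : H.loops, u (Sum.inl A) = u (Sum.inl B) := by
    intro A B
    obtain ⟨p⟩ := hc.preconnected A B
    induction p with
    | nil => rfl
    | cons hadj _ ih =>
      obtain ⟨-, v, h | h⟩ := hadj
      · exact (hj _ _ _ h.1 h.2).trans ih
      · exact (hj _ _ _ h.1 h.2).trans ih
  have hf : ∀ h : H.Free, ∃ A, u (Sum.inr h) = u (Sum.inl A) := by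
    intro h
    have hh : (h.1.1, !h.1.2) ∈ H.lines := (H.freeEquiv.symm h).2.1
    refine ⟨H.loopOf ⟨_, hh⟩, ?_⟩
    rw [← label_free, hu', label_of_mem (mem_loopOf ⟨_, hh⟩)]
  rcases A with A | a <;> rcases B with B | b
  · exact hl A B
  · obtain ⟨B, hB⟩ := hf b
    rw [hB, hl A B]
  · obtain ⟨A, hA⟩ := hf a
    rw [hA, hl A B]
  · obtain ⟨A, hA⟩ := hf a
    obtain ⟨B, hB⟩ := hf b
    rw [hA, hB, hl A B]

variable (H) in
/-- The two ends of a wavy line, as loop vertices of the closure. -/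
noncomputable def labelAt (s : Bool) (v : G.vertices H.lines) : H.loops ⊕ H.Free :=
  H.label (H.endAt v s)

/-- Each external wavy line adds one edge and one leaf, so the closure of a tree still has one more
node than edges. -/
theorem card_label [Finite V] (ht : H.IsTree) :
    Nat.card (H.loops ⊕ H.Free) = Nat.card (G.vertices H.lines) + 1 := by
  rw [Nat.card_sum, card_vertices, card_free, ← (H.isTree_iff.1 ht).2]
  ring

theorem edgeDiff_label_surjective [Finite V] (ht : H.IsTree) :
    Function.Surjective (edgeDiff (H.labelAt true) (H.labelAt false)) := by
  have := Fintype.ofFinite (H.loops ⊕ H.Free)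
  have := Fintype.ofFinite (G.vertices H.lines)
  refine edgeDiff_surjective (fun u hu => eq_of_label (H.isTree_iff.1 ht).1 hu) ?_
  rw [← Nat.card_eq_fintype_card, ← Nat.card_eq_fintype_card, card_label ht]

/-- On a tree, the differences of a function between the two sides of the ends vanish if they
cancel along the wavy lines. -/
theorem eq_of_flow [Finite V] (ht : H.IsTree) {a b : G.Ends H.lines → ℚ}
    (hab : ∀ h, b (H.closureFun h) = a h)
    (hd : ∀ v, a (H.endAt v true) - b (H.endAt v true) +
      (a (H.endAt v false) - b (H.endAt v false)) = 0) : a = b := by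
  have := Fintype.ofFinite (G.vertices H.lines)
  have := Fintype.ofFinite (G.Ends H.lines)
  have h0 : (fun v => a (H.endAt v true) - b (H.endAt v true)) = 0 := by
    -- The flow is tested against a potential `u` on the loop vertices. The total over all ends
    -- vanishes because the arcs permute the ends and preserve labels; grouping the ends by wavy
    -- line then gives the pairing with the differences of `u`.
    refine flow_eq_zero (edgeDiff_label_surjective ht) fun u => ?_
    have h1 : ∑ h, (a h - b h) * u (H.label h) = 0 := by
      have h2 : ∑ h, b h * u (H.label h) = ∑ h, a h * u (H.label h) := by
        rw [← Equiv.sum_comp H.closure]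
        refine Finset.sum_congr rfl fun h _ => ?_
        change b (H.closureFun h) * u (H.label (H.closureFun h)) = _
        rw [hab, label_closureFun]
      simp only [sub_mul, Finset.sum_sub_distrib, h2, sub_self]
    rw [← Equiv.sum_comp H.endsEquiv.symm, Fintype.sum_prod_type] at h1
    rw [← h1]
    refine Finset.sum_congr rfl fun v _ => ?_
    rw [Fintype.sum_bool]
    change _ = (a (H.endAt v true) - b (H.endAt v true)) * u (H.labelAt true v) +
      (a (H.endAt v false) - b (H.endAt v false)) * u (H.labelAt false v)
    linear_combination (-u (H.labelAt false v)) * hd v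
  have h1 : ∀ v, a (H.endAt v true) = b (H.endAt v true) := fun v => sub_eq_zero.1 (congrFun h0 v)
  ext ⟨⟨v, _ | _⟩, hv⟩
  · have := hd ⟨v, hv⟩
    rw [h1, sub_self, zero_add] at this
    exact sub_eq_zero.1 this
  · exact h1 ⟨v, hv⟩

/-- On a tree with exactly two external wavy lines of the same colour that are tied by wavy lines of
this colour, an open face of this colour runs from the one to the other. -/
theorem sameStrand_of_colorConn [Finite V] (ht : H.IsTree) {h₁ h₂ : HalfWavy V}
    (hh₁ : h₁ ∈ H.externalWavy) (hh₂ : h₂ ∈ H.externalWavy)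
    (hall : ∀ h ∈ H.externalWavy, h = h₁ ∨ h = h₂) (hne : h₁ ≠ h₂)
    (hcol : G.color h₁.1 = G.color h₂.1) {A B : H.loops} (hA : h₁ ∈ A.1) (hB : h₂ ∈ B.1)
    (hconn : H.ColorConn (G.color h₁.1) A B) : H.SameStrand h₁ h₂ := by
  classical
  refine ⟨hcol, ?_⟩
  by_contra! hns
  obtain ⟨c, hc⟩ : ∃ c, c = G.color h₁.1 := ⟨_, rfl⟩
  rw [← hc] at hns hconn hcol
  -- `a` and `b` indicate whether the field φ, respectively φ̄, of an end on `H` lies on the open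
  -- face `f`; `a - b` is the flux of `f` through the end.
  let f := G.faceAt H.lines c (Sum.inl h₁)
  let a : HalfWavy V → ℚ := fun h =>
    if h ∈ H.lines ∧ G.faceAt H.lines c (Sum.inl h) = f then 1 else 0
  let b : HalfWavy V → ℚ := fun h =>
    if h ∈ H.lines ∧ G.faceAt H.lines c (Sum.inr h) = f then 1 else 0
  have hab : ∀ h : G.Ends H.lines, b (H.closureFun h).1 = a h.1 := by
    intro h
    by_cases hh : h.1 ∈ H.lines
    · simp only [a, b, closureFun_mem_iff, faceAt_line hh (closureFun_next hh)]
    · simp [a, b, hh, closureFun_of_not_mem hh]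
  have ha1 : a h₁ = 1 := if_pos ⟨hh₁.1, rfl⟩
  have hb2 : b h₂ = 0 := if_neg fun h => hns.1 h.2.symm
  have hfree : ∀ h, h ∉ H.lines → a h - b h = 0 := fun h hh => by simp [a, b, hh]
  have hint : ∀ h ∈ H.lines, (h.1, !h.2) ∈ H.lines ∨ G.color h.1 ≠ c →
      a h - b h + (a (h.1, !h.2) - b (h.1, !h.2)) = 0 := by
    intro h hh hor
    by_cases hcc : c = G.color h.1
    · have hh' : (h.1, !h.2) ∈ H.lines := hor.resolve_right fun h => h hcc.symm
      have e1 := faceAt_strand (G := G) (S := H.lines) c h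
      have e2 := faceAt_strand (G := G) (S := H.lines) c (h.1, !h.2)
      have s1 := strand_color (G := G) h
      have s2 := strand_color (G := G) (h.1, !h.2)
      rw [← hcc] at s1
      change G.strand (G.color h.1) _ = _ at s2
      rw [← hcc] at s2
      rw [s1] at e1
      rw [s2, Bool.not_not] at e2
      simp only [a, b, hh, hh', true_and, e1, e2]
      ring
    · have hz : ∀ k : HalfWavy V, k.1 = h.1 → a k - b k = 0 := by
        intro k hk
        have e1 := faceAt_strand (G := G) (S := H.lines) c k
        rw [strand_of_ne (by rwa [hk])] at e1
        simp only [a, b, e1, sub_self]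
      rw [hz h rfl, zero_add]
      exact hz _ rfl
  -- Arcs conserve the total flux and the other wavy lines contribute nothing, so the fluxes of the
  -- two external lines cancel.
  have hsum : a h₁ - b h₁ + (a h₂ - b h₂) = 0 := by
    have := Fintype.ofFinite (G.Ends H.lines)
    have hs : ∑ h : G.Ends H.lines, (a h.1 - b h.1) = 0 := by
      rw [Finset.sum_sub_distrib, sub_eq_zero]
      conv_rhs => rw [← Equiv.sum_comp H.closure]
      exact Finset.sum_congr rfl fun h _ => (hab h).symm
    have := Fintype.ofFinite (G.vertices H.lines)
    rw [← Equiv.sum_comp H.endsEquiv.symm, Fintype.sum_prod_type] at hs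
    have hpair : ∀ (h : HalfWavy V) (hv : h.1 ∈ G.vertices H.lines),
        ∑ s, (a (H.endsEquiv.symm (⟨h.1, hv⟩, s)).1 - b (H.endsEquiv.symm (⟨h.1, hv⟩, s)).1) =
          a h - b h + (a (h.1, !h.2) - b (h.1, !h.2)) := by
      rintro ⟨v, _ | _⟩ hv
      · rw [Fintype.sum_bool, add_comm]
        rfl
      · rw [Fintype.sum_bool]
        rfl
    have hv₁ := mem_vertices_of_mem hh₁.1
    have hv₂ := mem_vertices_of_mem hh₂.1
    rw [Fintype.sum_eq_add ⟨h₁.1, hv₁⟩ ⟨h₂.1, hv₂⟩, hpair h₁ hv₁, hpair h₂ hv₂, hfree _ hh₁.2,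
      hfree _ hh₂.2, add_zero, add_zero] at hs
    · exact hs
    · intro heq
      have heq : h₁.1 = h₂.1 := congrArg Subtype.val heq
      rcases Bool.eq_or_eq_not h₂.2 h₁.2 with h | h
      · exact hne (Prod.ext heq h.symm)
      · apply hh₁.2
        rw [heq, ← h]
        exact hh₂.1
    · rintro ⟨v, hv⟩ ⟨hne₁, hne₂⟩
      obtain ⟨s, hs⟩ := mem_vertices_iff.1 hv
      rw [hpair (v, s) hv]
      refine hint (v, s) hs (Or.inl ?_)
      by_contra hs'
      rcases hall (v, s) ⟨hs, hs'⟩ with h | h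
      · exact hne₁ (Subtype.ext (congrArg Prod.fst h))
      · exact hne₂ (Subtype.ext (congrArg Prod.fst h))
  have hb0 : ∀ h, 0 ≤ b h := fun h => by simp only [b]; split_ifs <;> simp
  have hb1 : ∀ h, b h ≤ 1 := fun h => by simp only [b]; split_ifs <;> simp
  have ha0 : ∀ h, 0 ≤ a h := fun h => by simp only [a]; split_ifs <;> simp
  -- If `f` does not reach the φ̄ of `h₂`, both fluxes are nonnegative and hence zero. Then the flow
  -- vanishes on the whole tree, `a` is constant along the colour-`c` connection, and `a h₁ = 1`
  -- contradicts `a h₂ = b h₂ = 0`.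
  have hd1 : a h₁ - b h₁ = 0 := by linarith [hb1 h₁, ha0 h₂]
  have hd2 : a h₂ - b h₂ = 0 := by linarith
  have hd : ∀ h, h.1 ∈ G.vertices H.lines → h ∈ H.lines →
      a h - b h + (a (h.1, !h.2) - b (h.1, !h.2)) = 0 := by
    intro h _ hh
    by_cases hh' : (h.1, !h.2) ∈ H.lines
    · exact hint h hh (Or.inl hh')
    · rw [hfree _ hh', add_zero]
      rcases hall h ⟨hh, hh'⟩ with rfl | rfl
      · exact hd1
      · exact hd2
  have hflow := eq_of_flow ht (a := fun h => a h.1) (b := fun h => b h.1) hab (by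
    rintro ⟨v, hv⟩
    obtain ⟨s, hs⟩ := mem_vertices_iff.1 hv
    have := hd (v, s) hv hs
    cases s
    · rw [add_comm]
      exact this
    · exact this)
  have hconst : ∀ h ∈ H.lines, ∀ h', G.Next h h' → a h = a h' := by
    intro h hh h' hn
    have hv := mem_vertices_of_mem (mem_lines_of_next hn hh)
    have e1 : a h' = b h' := congrFun hflow ⟨h', hv⟩
    have e2 := hab ⟨h, mem_vertices_of_mem hh⟩
    rw [← hn.right_unique (closureFun_next (h := ⟨h, mem_vertices_of_mem hh⟩) hh)] at e2
    rw [e1, e2]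
  have hjoin : ∀ h, h ∈ H.lines → (h.1, !h.2) ∈ H.lines → G.color h.1 = c →
      a h = a (h.1, !h.2) := by
    intro h hh hh' hcc
    have e1 : a (h.1, !h.2) = b (h.1, !h.2) := congrFun hflow ⟨_, mem_vertices_of_mem hh'⟩
    have e2 := faceAt_strand (G := G) (S := H.lines) c h
    rw [← hcc, strand_color, hcc] at e2
    rw [e1]
    simp only [a, b, hh, hh', e2]
  have hAB := hconn.eq (u := fun A => a (H.rep A)) (by
    have key : ∀ (h : HalfWavy V) (A B : H.loops), h ∈ A.1 → (h.1, !h.2) ∈ B.1 →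
        G.color h.1 = c → a (H.rep A) = a (H.rep B) := by
      intro h A B hA hB hcc
      rw [eq_of_mem_loop hconst (H.rep_mem A) hA, eq_of_mem_loop hconst (H.rep_mem B) hB]
      exact hjoin h (mem_lines_of_mem hA) (mem_lines_of_mem hB) hcc
    rintro v A B (⟨h1, h2⟩ | ⟨h1, h2⟩) hv
    · exact key _ A B h1 h2 hv
    · exact key _ A B h1 h2 hv)
  simp only [eq_of_mem_loop hconst (H.rep_mem A) hA, eq_of_mem_loop hconst (H.rep_mem B) hB] at hAB
  linarith

end FeynmanGraph.PISubgraph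

namespace FeynmanGraph.PISubgraph

variable {V : Type*} {G : FeynmanGraph V} {H : G.PISubgraph}

/-! ### The degree of the closure of a tree -/

theorem bubbleEquiv_of_ne {c : Fin 6} {h : G.Ends H.lines} (hc : c ≠ G.color h.1.1) :
    G.bubbleEquiv H.lines c h = h := Subtype.ext (strand_of_ne hc)

theorem bubbleEquiv_endAt (v : G.vertices H.lines) (s : Bool) :
    G.bubbleEquiv H.lines (G.color v.1) (H.endAt v s) = H.endAt v (!s) :=
  Subtype.ext (strand_color (v.1, s))

theorem exists_endAt (h : G.Ends H.lines) : ∃ v s, h = H.endAt v s := ⟨⟨h.1.1, h.2⟩, h.1.2, rfl⟩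

section

variable [Finite V] {s : Set (Option (Fin 6))}

variable (H) in
/-- The closed coloured graph of the closure. -/
noncomputable def closureGraph : ColoredGraph (Option (Fin 6)) (G.Ends H.lines) (G.Ends H.lines) :=
  G.closedGraph H.lines H.closure

theorem quot_line (hs : none ∈ s) (h : G.Ends H.lines) :
    Quot.mk (H.closureGraph.Adj s) (Sum.inl h) = Quot.mk _ (Sum.inr (H.closureFun h)) :=
  Quot.sound (ColoredGraph.Adj.mk none hs h)

theorem quot_bubble {c : Fin 6} (hs : some c ∈ s) (h : G.Ends H.lines) :
    Quot.mk (H.closureGraph.Adj s) (Sum.inl h) =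
      Quot.mk _ (Sum.inr (G.bubbleEquiv H.lines c h)) :=
  Quot.sound (ColoredGraph.Adj.mk (some c) hs h)

theorem numComponents_univ (hc : H.Connected) : H.closureGraph.numComponents Set.univ = 1 := by
  have hbub : ∀ h : G.Ends H.lines, Quot.mk (H.closureGraph.Adj Set.univ) (Sum.inl h) =
      Quot.mk _ (Sum.inr h) := by
    intro h
    -- The shift by one only serves to name a non-special colour, whose bubble edge joins the two
    -- fields of the same end.
    have := quot_bubble (H := H) (Set.mem_univ (some (G.color h.1.1 + 1))) h
    rwa [bubbleEquiv_of_ne (by simp)] at this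
  have hlab : ∀ h, Quot.mk (H.closureGraph.Adj Set.univ) (Sum.inl (H.labelRep (H.label h))) =
      Quot.mk _ (Sum.inl h) :=
    eq_labelRep (f := fun h => Quot.mk (H.closureGraph.Adj Set.univ) (Sum.inl h)) fun h => by
      rw [hbub, ← quot_line (Set.mem_univ _)]
  have hconst := eq_of_label hc
    (u := fun A => Quot.mk (H.closureGraph.Adj Set.univ) (Sum.inl (H.labelRep A))) fun v => by
      rw [hlab, hlab, quot_bubble (Set.mem_univ (some (G.color v.1))), bubbleEquiv_endAt, ← hbub]
      rfl
  have hall : ∀ h h' : G.Ends H.lines,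
      Quot.mk (H.closureGraph.Adj Set.univ) (Sum.inl h) = Quot.mk _ (Sum.inl h') := by
    intro h h'
    rw [← hlab h, ← hlab h']
    exact hconst _ _
  obtain ⟨A⟩ := hc.nonempty
  refine Nat.card_eq_one_iff_unique.2 ⟨⟨?_⟩, ⟨Quot.mk _ (Sum.inl (H.labelRep (Sum.inl A)))⟩⟩
  intro x y
  obtain ⟨x | x, rfl⟩ := Quot.exists_rep x <;> obtain ⟨y | y, rfl⟩ := Quot.exists_rep y
  · exact hall x y
  · rw [← hbub y]; exact hall x y
  · rw [← hbub x]; exact hall x y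
  · rw [← hbub x, ← hbub y]; exact hall x y

variable (H) in
/-- The number of wavy lines of colour `c`. -/
noncomputable def numColor (c : Fin 6) : ℕ := Nat.card {v : G.vertices H.lines // G.color v.1 = c}

/-- On a tree no flow is possible, so both fields of an end lie on the same face. Faces of colour
`c` are thus the components of the forest formed by the wavy lines of that colour; they are counted
as the dimension of the space of functions on them. -/
theorem numComponents_none_some (ht : H.IsTree) (c : Fin 6) :
    H.closureGraph.numComponents {none, some c} + H.numColor c =
      Nat.card (G.vertices H.lines) + 1 := by
  have := Fintype.ofFinite (H.loops ⊕ H.Free)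
  have := Fintype.ofFinite (G.vertices H.lines)
  have hn : (none : Option (Fin 6)) ∈ ({none, some c} : Set (Option (Fin 6))) := by simp
  have hsc : some c ∈ ({none, some c} : Set (Option (Fin 6))) := by simp
  rw [← card_label ht, Nat.card_eq_fintype_card, numColor,
    ← finrank_constOn (edgeDiff_label_surjective ht) (fun v => G.color v.1 = c),
    ColoredGraph.numComponents, card_quot_eq_finrank]
  congr 1
  set r := H.closureGraph.Adj {none, some c}
  have hab : ∀ (y : Quot r → ℚ), (fun h => y (Quot.mk r (Sum.inl h))) =
      fun h => y (Quot.mk r (Sum.inr h)) := by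
    intro y
    refine eq_of_flow ht (fun h => congrArg y (quot_line hn h).symm) fun v => ?_
    by_cases hv : c = G.color v.1
    · have h1 : ∀ s, Quot.mk r (Sum.inl (H.endAt v s)) = Quot.mk r (Sum.inr (H.endAt v (!s))) := by
        intro s
        have := quot_bubble (H := H) hsc (H.endAt v s)
        rw [hv, bubbleEquiv_endAt, ← hv] at this
        exact this
      rw [h1, h1]
      simp only [Bool.not_true, Bool.not_false]
      ring
    · have h1 : ∀ s, Quot.mk r (Sum.inl (H.endAt v s)) = Quot.mk r (Sum.inr (H.endAt v s)) := by
        intro s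
        have := quot_bubble (H := H) hsc (H.endAt v s)
        rwa [bubbleEquiv_of_ne hv] at this
      rw [h1, h1]
      ring
  have hlab : ∀ (y : Quot r → ℚ) h,
      y (Quot.mk r (Sum.inl (H.labelRep (H.label h)))) = y (Quot.mk r (Sum.inl h)) := by
    intro y
    refine eq_labelRep (f := fun h => y (Quot.mk r (Sum.inl h))) fun h => ?_
    rw [congrFun (hab y) (H.closureFun h), quot_line hn]
  apply le_antisymm
  · let φ : (Quot r → ℚ) →ₗ[ℚ]
        constOn (H.labelAt true) (H.labelAt false) (fun v => G.color v.1 = c) :=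
      { toFun := fun y => ⟨fun A => y (Quot.mk r (Sum.inl (H.labelRep A))), by
          intro v hv
          have h1 := quot_bubble (H := H) hsc (H.endAt v true)
          rw [← hv, bubbleEquiv_endAt, hv] at h1
          change y (Quot.mk r (Sum.inl (H.labelRep (H.label (H.endAt v true))))) =
            y (Quot.mk r (Sum.inl (H.labelRep (H.label (H.endAt v false)))))
          rw [hlab y, hlab y]
          exact (congrArg y h1).trans (congrFun (hab y) (H.endAt v false)).symm⟩
        map_add' := fun y y' => rfl
        map_smul' := fun a y => rfl }
    refine LinearMap.finrank_le_finrank_of_injective (f := φ) ?_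
    rw [injective_iff_map_eq_zero]
    intro y hy
    have h0 : ∀ h, y (Quot.mk r (Sum.inl h)) = 0 := fun h => by
      rw [← hlab y]
      exact congrFun (congrArg Subtype.val hy) _
    ext x
    obtain ⟨x | x, rfl⟩ := Quot.exists_rep x
    · exact h0 x
    · exact (congrFun (hab y) x).symm.trans (h0 x)
  · have hlift : ∀ u : constOn (H.labelAt true) (H.labelAt false) (fun v => G.color v.1 = c),
        ∀ x y, r x y → Sum.elim (fun h => u.1 (H.label h)) (fun h => u.1 (H.label h)) x =
          Sum.elim (fun h => u.1 (H.label h)) (fun h => u.1 (H.label h)) y := by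
      rintro u _ _ ⟨a, ha, h⟩
      rcases ha with rfl | rfl
      · exact congrArg u.1 (label_closureFun h).symm
      · change u.1 (H.label h) = u.1 (H.label (G.bubbleEquiv H.lines c h))
        obtain ⟨v, s, rfl⟩ := exists_endAt h
        by_cases hv : c = G.color v.1
        · have hb : G.bubbleEquiv H.lines c (H.endAt v s) = H.endAt v (!s) := by
            rw [hv, bubbleEquiv_endAt]
          rw [hb]
          cases s
          · exact (u.2 v hv.symm).symm
          · exact u.2 v hv.symm
        · rw [bubbleEquiv_of_ne hv]
    let φ : constOn (H.labelAt true) (H.labelAt false) (fun v => G.color v.1 = c) →ₗ[ℚ]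
        (Quot r → ℚ) :=
      { toFun := fun u => Quot.lift _ (hlift u)
        map_add' := fun u u' => by
          ext x
          obtain ⟨x | x, rfl⟩ := Quot.exists_rep x <;> rfl
        map_smul' := fun a u => by
          ext x
          obtain ⟨x | x, rfl⟩ := Quot.exists_rep x <;> rfl }
    refine LinearMap.finrank_le_finrank_of_injective (f := φ) ?_
    rw [injective_iff_map_eq_zero]
    intro u hu
    ext A
    have := congrFun hu (Quot.mk r (Sum.inl (H.labelRep A)))
    change u.1 (H.label (H.labelRep A)) = 0 at this
    rwa [label_labelRep] at this

/-- Without arcs each bubble is separate: its two ends are joined if its special colour is `c` or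
`c'`, and form two components otherwise. -/
theorem numComponents_some_some {c c' : Fin 6} (hcc : c ≠ c') :
    H.closureGraph.numComponents {some c, some c'} + (H.numColor c + H.numColor c') =
      2 * Nat.card (G.vertices H.lines) := by
  classical
  have := Fintype.ofFinite (G.Ends H.lines)
  have := Fintype.ofFinite (G.vertices H.lines)
  -- `P` selects one end per component: the end `true` where the two ends are joined, both ends
  -- elsewhere.
  let P : G.Ends H.lines → Prop := fun h =>
    (G.color h.1.1 = c ∨ G.color h.1.1 = c') → h.1.2 = true
  have hs : some c ∈ ({some c, some c'} : Set (Option (Fin 6))) := by simp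
  have hs' : some c' ∈ ({some c, some c'} : Set (Option (Fin 6))) := by simp
  set r := H.closureGraph.Adj {some c, some c'}
  have hrefl : ∀ h, Quot.mk r (Sum.inl h) = Quot.mk r (Sum.inr h) := by
    intro h
    by_cases hc : c = G.color h.1.1
    · have := quot_bubble (H := H) hs' h
      rwa [bubbleEquiv_of_ne fun h => hcc (hc.trans h.symm)] at this
    · have := quot_bubble (H := H) hs h
      rwa [bubbleEquiv_of_ne hc] at this
  have hswap : ∀ v, (G.color v.1 = c ∨ G.color v.1 = c') →
      Quot.mk r (Sum.inl (H.endAt v false)) = Quot.mk r (Sum.inl (H.endAt v true)) := by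
    rintro v (hv | hv)
    · rw [hrefl (H.endAt v true)]
      have := quot_bubble (H := H) hs (H.endAt v false)
      rwa [← hv, bubbleEquiv_endAt, hv] at this
    · rw [hrefl (H.endAt v true)]
      have := quot_bubble (H := H) hs' (H.endAt v false)
      rwa [← hv, bubbleEquiv_endAt, hv] at this
  let κ : G.Ends H.lines → {h // P h} := fun h =>
    if hP : P h then ⟨h, hP⟩ else ⟨H.endAt ⟨h.1.1, h.2⟩ true, fun _ => rfl⟩
  have hκP : ∀ h (hP : P h), κ h = ⟨h, hP⟩ := fun h hP => dif_pos hP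
  have hκ : ∀ h, Quot.mk r (Sum.inl (κ h).1) = Quot.mk r (Sum.inl h) := by
    intro h
    by_cases hP : P h
    · rw [hκP h hP]
    · simp only [κ, dif_neg hP]
      simp only [P, Classical.not_imp, Bool.not_eq_true] at hP
      rw [← hswap _ hP.1]
      congr 2
      exact Subtype.ext (Prod.ext rfl hP.2.symm)
  have hκv : ∀ v, (G.color v.1 = c ∨ G.color v.1 = c') → ∀ s, (κ (H.endAt v s)).1 = H.endAt v true := by
    intro v hv s
    cases s
    · have : ¬ P (H.endAt v false) := fun h => Bool.false_ne_true (h hv)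
      simp only [κ, dif_neg this]
      rfl
    · rw [hκP _ fun _ => rfl]
  have hκb : ∀ d, (d = c ∨ d = c') → ∀ h, κ (G.bubbleEquiv H.lines d h) = κ h := by
    intro d hd h
    obtain ⟨v, s, rfl⟩ := exists_endAt h
    by_cases hv : d = G.color v.1
    · have hv' : G.color v.1 = c ∨ G.color v.1 = c' := hv ▸ hd
      rw [hv, bubbleEquiv_endAt]
      exact Subtype.ext ((hκv v hv' _).trans (hκv v hv' _).symm)
    · rw [bubbleEquiv_of_ne hv]
  let e : Quot r ≃ {h // P h} :=
    { toFun := Quot.lift (Sum.elim κ κ) <| by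
        rintro _ _ ⟨a, rfl | rfl, h⟩
        · exact (hκb c (Or.inl rfl) h).symm
        · exact (hκb c' (Or.inr rfl) h).symm
      invFun := fun h => Quot.mk r (Sum.inl h.1)
      left_inv := fun x => by
        obtain ⟨x | x, rfl⟩ := Quot.exists_rep x
        · exact hκ x
        · exact (hκ x).trans (hrefl x)
      right_inv := fun h => hκP h.1 h.2 }
  let e' : {h // ¬ P h} ≃ {v : G.vertices H.lines // G.color v.1 = c ∨ G.color v.1 = c'} :=
    { toFun := fun h => ⟨⟨h.1.1.1, h.1.2⟩, (Classical.not_imp.1 h.2).1⟩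
      invFun := fun v => ⟨H.endAt v.1 false, fun h => Bool.false_ne_true (h v.2)⟩
      left_inv := fun h => by
        refine Subtype.ext (Subtype.ext (Prod.ext rfl ?_))
        exact (Bool.eq_false_of_not_eq_true (Classical.not_imp.1 h.2).2).symm
      right_inv := fun v => rfl }
  have h1 : Nat.card {v : G.vertices H.lines // G.color v.1 = c ∨ G.color v.1 = c'} =
      H.numColor c + H.numColor c' := by
    simp only [numColor, Nat.card_eq_fintype_card]
    refine Fintype.card_subtype_or_disjoint _ _ ?_
    rw [Pi.disjoint_iff]
    intro v
    rw [Prop.disjoint_iff]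
    exact fun h => hcc (h.1.symm.trans h.2)
  rw [ColoredGraph.numComponents, Nat.card_congr e, ← h1, ← Nat.card_congr e', ← Nat.card_sum,
    Nat.card_congr (Equiv.sumCompl P), Nat.card_congr H.endsEquiv, Nat.card_prod,
    Nat.card_eq_fintype_card (α := Bool), Fintype.card_bool, mul_comm]

theorem sum_numColor : ∑ c, H.numColor c = Nat.card (G.vertices H.lines) := by
  rw [← Nat.card_congr (Equiv.sigmaFiberEquiv fun v : G.vertices H.lines => G.color v.1),
    Nat.card_sigma]
  rfl

/-- With N vertices, of which N_c have colour c, put w(0) = 1 and w(c) = N - N_c; the colours a, b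
have w(a) + w(b) faces. Around any cyclic ordering each weight occurs twice, giving 2 + 10N faces
against 4N nodes and 14N edges, hence genus zero. -/
theorem degree_closureGraph (ht : H.IsTree) : H.closureGraph.degree = 0 := by
  let w : Option (Fin 6) → ℚ := fun a =>
    a.elim 1 fun c => (Nat.card (G.vertices H.lines) : ℚ) - H.numColor c
  have hns : ∀ c, (H.closureGraph.numComponents {none, some c} : ℚ) = w none + w (some c) := by
    intro c
    have := congrArg (Nat.cast (R := ℚ)) (numComponents_none_some ht c)
    push_cast at this
    simp only [w, Option.elim]
    linarith
  have hw : ∀ a b, a ≠ b → (H.closureGraph.numComponents {a, b} : ℚ) = w a + w b := by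
    rintro (_ | c) (_ | c') hab
    · exact absurd rfl hab
    · exact hns c'
    · rw [Set.pair_comm, hns c, add_comm]
    · have := congrArg (Nat.cast (R := ℚ))
        (numComponents_some_some (H := H) fun h => hab (congrArg some h))
      push_cast at this
      simp only [w, Option.elim]
      linarith
  have hsum : ∑ a, w a = 1 + 5 * Nat.card (G.vertices H.lines) := by
    rw [Fintype.sum_option]
    simp only [w, Option.elim, Finset.sum_sub_distrib, Finset.sum_const, Finset.card_univ,
      Fintype.card_fin]
    rw [← Nat.cast_sum, sum_numColor]
    ring
  unfold ColoredGraph.degree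
  rw [Finset.sum_eq_zero, zero_div]
  intro ξ hξ
  have hcyc : ξ.IsCycleOn Set.univ := by
    simpa only [Finset.mem_filter, Finset.mem_univ, true_and] using hξ
  have hne : ∀ a, a ≠ ξ a := fun a =>
    (hcyc.apply_ne Set.nontrivial_univ (Set.mem_univ a)).symm
  rw [ColoredGraph.jacketGenus, numComponents_univ (H.isTree_iff.1 ht).1,
    Finset.sum_congr rfl fun a _ => hw a (ξ a) (hne a), Finset.sum_add_distrib,
    Equiv.sum_comp ξ w, hsum, Nat.card_congr H.endsEquiv, Nat.card_prod]
  simp only [Nat.card_eq_fintype_card (α := Bool), Fintype.card_bool, Fintype.card_option,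
    Fintype.card_fin]
  push_cast
  ring

theorem isMelonic_of_isTree (ht : H.IsTree) : G.IsMelonic H.lines :=
  ⟨H.closure, fun _ hh => closureFun_next hh, degree_closureGraph ht⟩

end

/-! ### Classification -/

section

variable [Finite V]

theorem omega_of_isTree (ht : H.IsTree) : H.omega = Module.finrank ℚ H.loopSpace
    - 4 * (Nat.card H.loops : ℤ) + 4 - 2 * H.numExternalWavy := by
  rw [omega_eq, ← (H.isTree_iff.1 ht).2]
  push_cast
  ring

theorem omega_of_numExternalWavy_eq_one (ht : H.IsTree) (h1 : H.numExternalWavy = 1) :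
    H.omega = 2 := by
  obtain ⟨hsub, ⟨h₀⟩⟩ := Nat.card_eq_one_iff_unique.1 h1
  have hA := mem_loopOf ⟨h₀.1, h₀.2.1⟩
  have hle := finrank_loopSpace_le (H.isTree_iff.1 ht).1 h₀.2 hA
  have hge := le_finrank_loopSpace ht (h₀ := h₀.1) (A₀ := H.loopOf ⟨h₀.1, h₀.2.1⟩) (by
    intro h hh A hA'
    obtain rfl : h = h₀.1 := congrArg Subtype.val (Subsingleton.elim (⟨h, hh⟩ : H.externalWavy) h₀)
    rw [loopOf_eq _ hA']
    exact ⟨rfl, Relation.ReflTransGen.refl⟩)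
  rw [omega_of_isTree ht, h1]
  push_cast
  omega

theorem eq_or_eq_of_numExternalWavy_eq_two (h2 : H.numExternalWavy = 2) {h h' : HalfWavy V}
    (hh : h ∈ H.externalWavy) (hh' : h' ∈ H.externalWavy) (hne : h ≠ h') :
    ∀ k ∈ H.externalWavy, k = h ∨ k = h' := by
  intro k hk
  by_contra! hkn
  have hsub : ({k, h, h'} : Set (HalfWavy V)) ⊆ H.externalWavy := by
    rintro x (rfl | rfl | rfl) <;> assumption
  have := Set.ncard_le_ncard hsub (Set.toFinite _)
  rw [← Nat.card_coe_set_eq H.externalWavy] at this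
  rw [Set.ncard_eq_three.2 ⟨k, h, h', hkn.1, hkn.2, hne, rfl⟩] at this
  rw [numExternalWavy] at h2
  omega

theorem omega_of_hasMonocolorPair (ht : H.IsTree) (hm : H.HasMonocolorPair) : H.omega = 0 := by
  obtain ⟨h2, h, hh, h', hh', hne, hs⟩ := hm
  have hA := mem_loopOf ⟨h, hh.1⟩
  have hle := finrank_loopSpace_le (H.isTree_iff.1 ht).1 hh hA
  have hge := le_finrank_loopSpace ht (h₀ := h) (A₀ := H.loopOf ⟨h, hh.1⟩) (by
    intro k hk A hkA
    rcases eq_or_eq_of_numExternalWavy_eq_two h2 hh hh' hne k hk with rfl | rfl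
    · rw [loopOf_eq _ hkA]
      exact ⟨rfl, Relation.ReflTransGen.refl⟩
    · exact ⟨hs.1.symm, colorConn_of_sameStrand hA hkA hs⟩)
  rw [omega_of_isTree ht, h2]
  push_cast
  omega

theorem hasMonocolorPair_of_finrank (ht : H.IsTree) (h2 : H.numExternalWavy = 2)
    (hdim : 4 * Nat.card H.loops ≤ Module.finrank ℚ H.loopSpace) : H.HasMonocolorPair := by
  have hn : H.externalWavy.ncard = 2 := by rw [← Nat.card_coe_set_eq]; exact h2
  obtain ⟨h, h', hne, heq⟩ := Set.ncard_eq_two.1 hn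
  have hh : h ∈ H.externalWavy := by rw [heq]; simp
  have hh' : h' ∈ H.externalWavy := by rw [heq]; simp
  refine ⟨h2, h, hh, h', hh', hne, ?_⟩
  have hA := mem_loopOf ⟨h, hh.1⟩
  have hA' := mem_loopOf ⟨h', hh'.1⟩
  obtain ⟨hcol, hconn⟩ := colorConn_of_eq_zero (H.isTree_iff.1 ht).1 hh hA hdim
    (fun u hu => hu.2.2 h' hh' _ hA')
  refine sameStrand_of_colorConn ht hh hh' (eq_or_eq_of_numExternalWavy_eq_two h2 hh hh' hne) hne
    hcol.symm hA hA' ?_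
  rw [← hcol]
  exact hconn.symm

theorem classification_of_omega_nonneg (hc : H.Connected) (hext : 0 < H.numExternalWavy)
    (hω : 0 ≤ H.omega) : H.IsTree ∧ (H.numExternalWavy = 1 ∨ H.HasMonocolorPair) := by
  obtain ⟨⟨h₀, hh₀⟩⟩ : Nonempty H.externalWavy := (Nat.card_pos_iff.1 hext).1
  have hle := finrank_loopSpace_le hc hh₀ (mem_loopOf ⟨h₀, hh₀.1⟩)
  have hn := H.card_loops_le hc
  rw [omega_eq] at hω
  -- From 0 ≤ ω ≤ 4(n - I) - 2E and E ≥ 1 follows n > I, so n = I + 1.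
  have ht : H.IsTree := H.isTree_iff.2 ⟨hc, by omega⟩
  refine ⟨ht, ?_⟩
  have hn' := (H.isTree_iff.1 ht).2
  by_cases h1 : H.numExternalWavy = 1
  · exact Or.inl h1
  -- On a tree the bound reads 2E ≤ 4, so E = 2 here, and then ω ≥ 0 leaves no slack in the
  -- dimension.
  · exact Or.inr (hasMonocolorPair_of_finrank ht (by omega) (by omega))

end

end FeynmanGraph.PISubgraph

theorem mainTheorem3 {V : Type*} [Finite V] (G : FeynmanGraph V) (H : G.PISubgraph)
    (hconn : H.Connected) (hext : 0 < H.numExternalWavy) :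
    (0 ≤ H.omega → G.IsMelonic H.lines ∧
      (G.numExternalLines H.lines = 2 ∨ G.numExternalLines H.lines = 4)) ∧
    (0 ≤ H.omega ↔ H.IsTree ∧ (H.numExternalWavy = 1 ∨ H.HasMonocolorPair)) ∧
    (H.IsTree → H.numExternalWavy = 1 → G.numExternalLines H.lines = 2 ∧ H.omega = 2) ∧
    (H.IsTree → H.HasMonocolorPair → G.numExternalLines H.lines = 4 ∧ H.omega = 0) := by
  open FeynmanGraph.PISubgraph in
  refine ⟨fun hω => ?_, ⟨classification_of_omega_nonneg hconn hext, ?_⟩, fun ht h1 => ?_,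
    fun ht hm => ?_⟩
  · obtain ⟨ht, h1 | hm⟩ := classification_of_omega_nonneg hconn hext hω
    · exact ⟨isMelonic_of_isTree ht, Or.inl (by rw [numExternalLines_eq, h1])⟩
    · exact ⟨isMelonic_of_isTree ht, Or.inr (by rw [numExternalLines_eq, hm.1])⟩
  · rintro ⟨ht, h1 | hm⟩
    · rw [omega_of_numExternalWavy_eq_one ht h1]
      norm_num
    · rw [omega_of_hasMonocolorPair ht hm]
  · exact ⟨by rw [numExternalLines_eq, h1], omega_of_numExternalWavy_eq_one ht h1⟩
  · exact ⟨by rw [numExternalLines_eq, hm.1], omega_of_hasMonocolorPair ht hm⟩
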